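/- **Setting.** Let $k$ be a field, $n\ge 0$, $I=\{1,\dots,n\}$, let $\alpha_1,\dots,\alpha_n$ be the standard basis of $\mathbb Z^n$, and let $\mathbb N=\{0,1,2,\dots\}$. Let $\chi:\mathbb Z^n\times\mathbb Z^n\to k^\times$ be a bicharacter whose matrix $q_{ij}=\chi(\alpha_i,\alpha_j)$ is symmetric. Let $V$ have basis $E_1,\dots,E_n$ and regard the tensor algebra $T(V)$ as a braided Hopf algebra with primitive generators $E_i$ and braiding $E_i\otimes E_j\mapsto q_{ij}E_j\otimes E_i$. Let $\mathcal I\subseteq\bigoplus_{m\ge 2}T(V)_m$ be a $\mathbb Z^n$-graded biideal, so that $U^+=T(V)/\mathcal I$ is a pre-Nichols algebra of diagonal type. Let $\tau:I\to I$ be a bijection with $\tau^2=\mathrm{id}$, $q_{\tau(i)\tau(j)}=q_{ij}$ for all $i,j$, and $\tau(\mathcal I)=\mathcal I$, where $\tau$ acts on $T(V)$ by $E_i\mapsto E_{\tau(i)}$. Let $\mathbf c=(c_1,\dots,c_n)\in k^n$. Let $U(\chi)$ be the algebra generated by $E_i,F_i$ $(i\in I)$ and $K_\mu$ $(\mu\in\mathbb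 Z^n)$ with relations $K_0=1$, $K_{\mu+\nu}=K_\mu K_\nu$, $K_\mu E_j=\chi(\mu,\alpha_j)E_jK_\mu$, $K_\mu F_j=\chi(\mu,\alpha_j)^{-1}F_jK_\mu$, $E_iF_j-F_jE_i=\delta_{ij}(K_i-K_i^{-1})$ with $K_i=K_{\alpha_i}$, and $p(E_1,\dots,E_n)=0=p(F_1,\dots,F_n)$ for all $p\in\mathcal I$. Let $U^{\pm}$ be the subalgebras generated by the $E_i$ and by the $F_i$ respectively, graded by $\deg E_i=\alpha_i$, $\deg F_i=-\alpha_i$; let $H$ be the span of the $K_\mu$, and $G^-$ the subalgebra generated by the $F_iK_i$. Let $P_\mu$ and $\pi_{\alpha,\beta}$ denote the projections onto the summands of $$U(\chi)=\bigoplus_{\mu\in\mathbb Z^n}U^+K_\mu G^-,\qquad U(\chi)=\bigoplus_{\alpha,\beta\in\mathbb N^n}U^+_\alpha H U^-_{-\beta}.\tag{1}$$ Let $\mathbb Z^n_\theta=\{\mu\in\mathbb Z^n : -\tau(\mu)=\mu\}$, where $\tau(\alpha_i)=\alpha_{\tau(i)}$, and let $M=-\mathbb N^n+\mathbb Z^n_\theta$.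 Let $U(\chi)^{\mathrm{poly}}\subseteq U(\chi)$ be the subalgebra generated by $\widetilde E_i=E_iK_i^{-1}$, $F_i$, $K_i^{-1}$, $K_iK_{\tau(i)}^{-1}$ $(i\in I)$, filtered by giving these generators degrees $1,1,1,0$. The negative Heisenberg double is the associated graded algebra $\mathrm{Heis}(\chi)^\vee=\mathrm{gr}(U(\chi)^{\mathrm{poly}})$. The classes of the generators are denoted by the same symbols. Send $K_\mu$, for $\mu\in M$, to $K_\mu\in U(\chi)^{\mathrm{poly}}$ and to its class in degree $-\sum_i\mu_i$ of $\mathrm{Heis}(\chi)^\vee$; this defines algebra homomorphisms $$k[K_\mu\mid\mu\in M]\to U(\chi)^{\mathrm{poly}},\qquad k[K_\mu\mid\mu\in M]\to\mathrm{Heis}(\chi)^\vee.\tag{2}$$ Let $G^+_+$ and $U^-_+$ be the spans in $\mathrm{Heis}(\chi)^\vee$ of the nonempty words in the $\widetilde E_i$ and in the $F_i$ respectively, and let $\pi^\vee_{0,0}$ be the projection onto the first summand of $$\mathrm{Heis}(\chi)^\vee=k[K_\mu\mid\mu\in M]\oplus\big(G^+_+\,\mathrm{Heis}(\chi)^\vee+\mathrm{Heis}(\chi)^\vee\,U^-_+\big).\tag{3}$$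 Finally put $B_i=F_i+c_iE_{\tau(i)}K_i^{-1}\in U(\chi)$ and $B_i^\vee=F_i+c_i\widetilde E_{\tau(i)}(K_{\tau(i)}K_i^{-1})\in\mathrm{Heis}(\chi)^\vee$. **Theorem.** The direct sum decompositions (1) and (3) hold and both homomorphisms (2) are injective, so that the projections are well defined and $k[K_\mu\mid\mu\in M]$ is a subalgebra of both $U(\chi)^{\mathrm{poly}}$ and $\mathrm{Heis}(\chi)^\vee$. For every $\lambda\in\mathbb N^n$ and every noncommutative polynomial $p(x_1,\dots,x_n)$ that is homogeneous of multidegree $\lambda$, the following equality holds in $k[K_\mu\mid\mu\in M]$: $$\pi_{0,0}\circ P_{-\lambda}\big(p(B_1,\dots,B_n)\big)=\pi^\vee_{0,0}\big(p(B_1^\vee,\dots,B_n^\vee)\big).$$ Moreover, if $\lambda$ does not lie in the submonoid $\sum_{i\in I}\mathbb N(\alpha_i+\alpha_{\tau(i)})$ of $\mathbb N^n$, then this element is zero, and also $P_{-\lambda}\circ\pi_{0,0}\big(p(B_1,\dots,B_n)\big)=0$. -/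

import Mathlib

noncomputable section

namespace QuantumDouble

section AssociatedGraded

variable {k A : Type*} [CommRing k] [Ring A] [Algebra k A]

/-- The part of a filtration that lies strictly below step `m`; for an increasing filtration this
is the step `m - 1`, and it is zero for `m = 0`. -/
def below (F : ℕ → Submodule k A) (m : ℕ) : Submodule k A := ⨆ i < m, F i

/-- The `m`-th graded piece, the quotient of `F m` by the previous step of the filtration. -/
def GrPiece (F : ℕ → Submodule k A) (m : ℕ) : Type _ :=
  ↥(F m) ⧸ (below F m).comap (F m).subtype

instance (F : ℕ → Submodule k A) (m : ℕ) : AddCommGroup (GrPiece F m) :=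
  inferInstanceAs (AddCommGroup (↥(F m) ⧸ (below F m).comap (F m).subtype))

instance (F : ℕ → Submodule k A) (m : ℕ) : Module k (GrPiece F m) :=
  inferInstanceAs (Module k (↥(F m) ⧸ (below F m).comap (F m).subtype))

/-- The quotient map from `F m` to the `m`-th graded piece. -/
def grMkHom (F : ℕ → Submodule k A) (m : ℕ) : ↥(F m) →ₗ[k] GrPiece F m :=
  Submodule.mkQ ((below F m).comap (F m).subtype)

/-- The class in the `m`-th graded piece of an element of `F m`. -/
def grMk (F : ℕ → Submodule k A) (m : ℕ) (a : A) (ha : a ∈ F m) : GrPiece F m :=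
  grMkHom F m ⟨a, ha⟩

theorem grMk_sigma {F : ℕ → Submodule k A} {i j : ℕ} {a b : A} (ha : a ∈ F i) (hb : b ∈ F j)
    (hij : i = j) (hab : a = b) :
    GradedMonoid.mk (A := GrPiece F) i (grMk F i a ha) = GradedMonoid.mk j (grMk F j b hb) := by
  subst hij; subst hab; rfl

theorem grMk_surj {F : ℕ → Submodule k A} {m : ℕ} (x : GrPiece F m) :
    ∃ a ha, x = grMk F m a ha := by
  obtain ⟨⟨a, ha⟩, rfl⟩ := Submodule.Quotient.mk_surjective _ x
  exact ⟨a, ha, rfl⟩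

variable (F : ℕ → Submodule k A) [SetLike.GradedMonoid F]

theorem below_mul {i j : ℕ} {a b : A} (ha : a ∈ below F i) (hb : b ∈ F j) :
    a * b ∈ below F (i + j) := by
  have h : below F i ≤ (below F (i + j)).comap (LinearMap.mulRight k b) := by
    refine iSup₂_le fun l hl x hx => ?_
    have h2 : F (l + j) ≤ below F (i + j) :=
      le_iSup₂_of_le (f := fun l (_ : l < i + j) => F l) (l + j) (by omega) le_rfl
    exact h2 (SetLike.mul_mem_graded hx hb)
  exact h ha

theorem mul_below {i j : ℕ} {a b : A} (ha : a ∈ F i) (hb : b ∈ below F j) :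
    a * b ∈ below F (i + j) := by
  have h : below F j ≤ (below F (i + j)).comap (LinearMap.mulLeft k a) := by
    refine iSup₂_le fun l hl x hx => ?_
    have h2 : F (i + l) ≤ below F (i + j) :=
      le_iSup₂_of_le (f := fun l (_ : l < i + j) => F l) (i + l) (by omega) le_rfl
    exact h2 (SetLike.mul_mem_graded ha hx)
  exact h hb

/-- Multiplication of graded pieces, `[a] * [b] = [a * b]`. -/
def grMul (i j : ℕ) : GrPiece F i →ₗ[k] GrPiece F j →ₗ[k] GrPiece F (i + j) :=
  Submodule.liftQ _
    (LinearMap.mk₂ k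
      (fun (a : F i) => Submodule.liftQ ((below F j).comap (F j).subtype)
        ((grMkHom F (i + j)).comp (((LinearMap.mulLeft k (a : A)).comp (F j).subtype).codRestrict
          (F (i + j)) fun b => SetLike.mul_mem_graded a.2 b.2))
        (by
          intro b hb
          exact (Submodule.Quotient.mk_eq_zero _).2 (mul_below F a.2 hb)))
      (by
        intro a a' x
        obtain ⟨b, hb, rfl⟩ := grMk_surj x
        refine congrArg (grMkHom F _) (Subtype.ext ?_)
        exact add_mul _ _ _)
      (by
        intro r a x
        obtain ⟨b, hb, rfl⟩ := grMk_surj x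
        refine congrArg (grMkHom F _) (Subtype.ext ?_)
        exact smul_mul_assoc _ _ _)
      (by intro a x y; exact map_add _ _ _)
      (by intro r a x; exact map_smul _ _ _))
    (by
      intro a ha
      refine LinearMap.ext fun x => ?_
      obtain ⟨b, hb, rfl⟩ := grMk_surj x
      exact (Submodule.Quotient.mk_eq_zero _).2 (below_mul F ha hb))

theorem grMul_mk {i j : ℕ} {a b : A} (ha : a ∈ F i) (hb : b ∈ F j) :
    grMul F i j (grMk F i a ha) (grMk F j b hb) =
      grMk F (i + j) (a * b) (SetLike.mul_mem_graded ha hb) := rfl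

instance grGMul : GradedMonoid.GMul (GrPiece F) where
  mul x y := grMul F _ _ x y

instance grGOne : GradedMonoid.GOne (GrPiece F) where
  one := grMk F 0 1 SetLike.GradedOne.one_mem

instance grGRing : DirectSum.GRing (GrPiece F) where
  mul_zero x := map_zero (grMul F _ _ x)
  zero_mul y := by
    change grMul F _ _ 0 y = 0
    simp
  mul_add x y z := map_add (grMul F _ _ x) y z
  add_mul x y z := by
    change grMul F _ _ (x + y) z = grMul F _ _ x z + grMul F _ _ y z
    simp
  one_mul := by
    rintro ⟨i, x⟩
    obtain ⟨a, ha, rfl⟩ := grMk_surj x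
    exact grMk_sigma _ _ (zero_add i) (one_mul a)
  mul_one := by
    rintro ⟨i, x⟩
    obtain ⟨a, ha, rfl⟩ := grMk_surj x
    exact grMk_sigma _ _ (add_zero i) (mul_one a)
  mul_assoc := by
    rintro ⟨i, x⟩ ⟨j, y⟩ ⟨l, z⟩
    obtain ⟨a, ha, rfl⟩ := grMk_surj x
    obtain ⟨b, hb, rfl⟩ := grMk_surj y
    obtain ⟨c, hc, rfl⟩ := grMk_surj z
    exact grMk_sigma _ _ (add_assoc i j l) (mul_assoc a b c)
  natCast m := m • GradedMonoid.GOne.one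
  natCast_zero := zero_smul _ _
  natCast_succ m := succ_nsmul _ _
  intCast z := z • GradedMonoid.GOne.one
  intCast_ofNat m := natCast_zsmul _ _
  intCast_negSucc_ofNat m := negSucc_zsmul _ _

instance grGAlgebra : DirectSum.GAlgebra k (GrPiece F) where
  toFun := (LinearMap.toSpanSingleton k (GrPiece F 0) GradedMonoid.GOne.one).toAddMonoidHom
  map_one := one_smul k (GradedMonoid.GOne.one : GrPiece F 0)
  map_mul r s := by
    refine grMk_sigma (F := F) (a := (r * s) • (1 : A)) (b := (r • (1 : A)) * (s • (1 : A)))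
      ((F 0).smul_mem _ SetLike.GradedOne.one_mem)
      (SetLike.mul_mem_graded ((F 0).smul_mem _ SetLike.GradedOne.one_mem)
        ((F 0).smul_mem _ SetLike.GradedOne.one_mem)) (zero_add 0).symm ?_
    rw [mul_smul, smul_mul_assoc, one_mul]
  commutes r x := by
    obtain ⟨i, x⟩ := x
    obtain ⟨a, ha, rfl⟩ := grMk_surj x
    refine grMk_sigma (F := F) (a := (r • (1 : A)) * a) (b := a * (r • (1 : A)))
      (SetLike.mul_mem_graded ((F 0).smul_mem _ SetLike.GradedOne.one_mem) ha)
      (SetLike.mul_mem_graded ha ((F 0).smul_mem _ SetLike.GradedOne.one_mem))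
      ((zero_add i).trans (add_zero i).symm) ?_
    simp
  smul_def r x := by
    obtain ⟨i, x⟩ := x
    obtain ⟨a, ha, rfl⟩ := grMk_surj x
    refine grMk_sigma (F := F) (a := r • a) (b := (r • (1 : A)) * a)
      ((F i).smul_mem _ ha)
      (SetLike.mul_mem_graded ((F 0).smul_mem _ SetLike.GradedOne.one_mem) ha)
      (zero_add i).symm ?_
    simp

/-- The associated graded algebra of a filtered algebra: the direct sum of the quotients
`F m / F (m - 1)`, with product `[a] * [b] = [a * b]`. -/
abbrev AssocGraded : Type _ := DirectSum ℕ (GrPiece F)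

/-- The class in degree `m` of the associated graded algebra of an element of `F m`. -/
def symb (m : ℕ) (a : A) (ha : a ∈ F m) : AssocGraded F :=
  DirectSum.of (GrPiece F) m (grMk F m a ha)

theorem symb_mul {i j : ℕ} {a b : A} (ha : a ∈ F i) (hb : b ∈ F j) :
    symb F i a ha * symb F j b hb = symb F (i + j) (a * b) (SetLike.mul_mem_graded ha hb) :=
  DirectSum.of_mul_of _ _

theorem symb_congr {A : Type*} [Ring A] [Algebra k A] (F : ℕ → Submodule k A) {i j : ℕ} {a b : A}
    (ha : a ∈ F i) (hb : b ∈ F j) (hij : i = j) (hab : a = b) : symb F i a ha = symb F j b hb := by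
  subst hij; subst hab; rfl

/-- The filtration of an algebra given by a degree function on a family of elements: step `m` is
spanned by the products of total degree at most `m`. -/
def degFiltration (k : Type*) {A G : Type*} [CommRing k] [Ring A] [Algebra k A]
    (gen : G → A) (deg : G → ℕ) (m : ℕ) : Submodule k A :=
  Submodule.span k {a | ∃ w : List G, (w.map deg).sum ≤ m ∧ (w.map gen).prod = a}

instance degFiltration_graded {G : Type*} (gen : G → A) (deg : G → ℕ) :
    SetLike.GradedMonoid (degFiltration k gen deg) where
  one_mem := Submodule.subset_span ⟨[], by simp, by simp⟩
  mul_mem := by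
    intro i j a b ha hb
    have h : degFiltration k gen deg i * degFiltration k gen deg j ≤
        degFiltration k gen deg (i + j) := by
      unfold degFiltration
      rw [Submodule.span_mul_span, Submodule.span_le]
      rintro _ ⟨_, ⟨v, hv, rfl⟩, _, ⟨w, hw, rfl⟩, rfl⟩
      refine Submodule.subset_span ⟨v ++ w, ?_, by simp⟩
      simp; omega
    exact h (Submodule.mul_mem_mul ha hb)

end AssociatedGraded
section Projections

open Classical in
/-- The projection onto `V` along `W`, a linear endomorphism, when the ambient space is the direct
sum of `V` and `W` (and zero otherwise). -/
def projAlong {k M : Type*} [Ring k] [AddCommGroup M] [Module k M] (V W : Submodule k M) :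
    M →ₗ[k] M :=
  if h : IsCompl V W then V.projection W h else 0

/-- The canonical projection onto the `i`-th summand of a direct sum decomposition. -/
def componentProj {k M ι : Type*} [Ring k] [AddCommGroup M] [Module k M] (W : ι → Submodule k M)
    (i : ι) : M →ₗ[k] M :=
  projAlong (W i) (⨆ j, ⨆ (_ : j ≠ i), W j)

end Projections

section NoncommutativePolynomials

/-- Noncommutative polynomials in `x_1, ..., x_n`; this is also the tensor algebra of the vector
space with basis `E_1, ..., E_n`. -/
abbrev NCPoly (k : Type*) [Field k] (n : ℕ) : Type _ := FreeAlgebra k (Fin n)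

variable (k : Type*) [Field k] {n : ℕ}

/-- The noncommutative monomial of a word. -/
def monomialOf (w : List (Fin n)) : NCPoly k n := (w.map (FreeAlgebra.ι k)).prod

/-- The noncommutative polynomials that are homogeneous of multidegree `l`: the span of the words
in which each letter `x_i` occurs exactly `l i` times. -/
def homogeneous (l : Fin n → ℕ) : Submodule k (NCPoly k n) :=
  Submodule.span k {p | ∃ w : List (Fin n), (∀ i, w.count i = l i) ∧ monomialOf k w = p}

/-- The part of the tensor algebra in tensor degrees at least two. -/
def degreeAtLeastTwo (n : ℕ) : Submodule k (NCPoly k n) :=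
  Submodule.span k {p | ∃ w : List (Fin n), 2 ≤ w.length ∧ monomialOf k w = p}

/-- The algebra automorphism `x_i ↦ x_{τ i}`. -/
def permHom (τ : Equiv.Perm (Fin n)) : NCPoly k n →ₐ[k] NCPoly k n :=
  FreeAlgebra.lift k fun i => FreeAlgebra.ι k (τ i)

end NoncommutativePolynomials

section Bicharacter

variable {k : Type*} [Field k] {n : ℕ}

/-- Bicharacters on `ℤ^n` with values in the unit group of `k`. -/
abbrev Bicharacter (k : Type*) [Field k] (n : ℕ) : Type _ :=
  (Fin n → ℤ) →+ (Fin n → ℤ) →+ Additive kˣ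

/-- The standard basis vector `α_i` of `ℤ^n`. -/
def sroot (i : Fin n) : Fin n → ℤ := Pi.single i 1

/-- The value of a bicharacter, as an element of the field. -/
def chi (χ : Bicharacter k n) (a b : Fin n → ℤ) : k := ((χ a b).toMul : kˣ)

/-- The matrix entry `q_ij`. -/
def qmat (χ : Bicharacter k n) (i j : Fin n) : k := chi χ (sroot i) (sroot j)

/-- The action of the group-like `K_i` on the tensor algebra, `K_i · x_j = q_ij x_j`. -/
def groupAct (χ : Bicharacter k n) (i : Fin n) : NCPoly k n →ₐ[k] NCPoly k n :=
  FreeAlgebra.lift k fun j => qmat χ i j • FreeAlgebra.ι k j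

/-- Left multiplication by `x_i ⊗ 1 + 1 ⊗ x_i` in the braided tensor square of the tensor algebra,
where `(1 ⊗ x_i) (a ⊗ b) = (K_i · a) ⊗ x_i b`. -/
def braidedLeftMul (χ : Bicharacter k n) (i : Fin n) :
    Module.End k (TensorProduct k (NCPoly k n) (NCPoly k n)) :=
  TensorProduct.map (LinearMap.mulLeft k (FreeAlgebra.ι k i)) LinearMap.id +
    TensorProduct.map (groupAct χ i).toLinearMap (LinearMap.mulLeft k (FreeAlgebra.ι k i))

/-- The braided coproduct of the tensor algebra: the algebra homomorphism into the braided tensor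
square for which every `x_i` is primitive. It is obtained by letting the product of the elements
`x_i ⊗ 1 + 1 ⊗ x_i` act on `1 ⊗ 1`. -/
def braidedCoproduct (χ : Bicharacter k n) :
    NCPoly k n →ₗ[k] TensorProduct k (NCPoly k n) (NCPoly k n) :=
  (LinearMap.applyₗ (TensorProduct.tmul k 1 1)).comp
    (FreeAlgebra.lift k (braidedLeftMul χ)).toLinearMap

/-- `I` is a `ℤ^n`-graded biideal of the braided Hopf algebra `T(V)`, contained in the tensor
degrees at least two; the quotient `T(V) / I` is then a pre-Nichols algebra. -/
structure IsGradedBiideal (χ : Bicharacter k n) (I : Ideal (NCPoly k n)) : Prop where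
  twoSided : I.IsTwoSided
  graded : ∀ p ∈ I, p ∈ ⨆ l : Fin n → ℕ, (I.restrictScalars k ⊓ homogeneous k l)
  degree : I.restrictScalars k ≤ degreeAtLeastTwo k n
  coideal : ∀ p ∈ I, braidedCoproduct χ p ∈
    LinearMap.range (TensorProduct.map (I.restrictScalars k).subtype
        (LinearMap.id : NCPoly k n →ₗ[k] NCPoly k n)) ⊔
      LinearMap.range (TensorProduct.map (LinearMap.id : NCPoly k n →ₗ[k] NCPoly k n)
        (I.restrictScalars k).subtype)

end Bicharacter

section DrinfeldDouble

variable {k : Type*} [Field k] {n : ℕ}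

/-- Generators of the Drinfeld double; `K l` stands for `K_1^{l_1} ... K_n^{l_n}`. -/
inductive DGen (n : ℕ) : Type
  | E (i : Fin n)
  | F (i : Fin n)
  | K (l : Fin n → ℤ)

/-- The free generators. -/
def fgen (k : Type*) [Field k] {n : ℕ} (g : DGen n) : FreeAlgebra k (DGen n) := FreeAlgebra.ι k g

/-- The defining relations of the Drinfeld double `U(χ)` of the pre-Nichols algebra `T(V) / I`:
the elements `K l` multiply as in the group algebra of `ℤ^n`, they commute with the `E_j` and `F_j`
up to the bicharacter, `E_i F_j - F_j E_i = δ_ij (K_i - K_i⁻¹)`, and `p(E) = 0`, `p(F) = 0` for all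
`p ∈ I`. -/
inductive DRel (χ : Bicharacter k n) (I : Ideal (NCPoly k n)) :
    FreeAlgebra k (DGen n) → FreeAlgebra k (DGen n) → Prop
  | K_zero : DRel χ I (fgen k (.K 0)) 1
  | K_add (a b : Fin n → ℤ) :
      DRel χ I (fgen k (.K (a + b))) (fgen k (.K a) * fgen k (.K b))
  | K_E (a : Fin n → ℤ) (j : Fin n) :
      DRel χ I (fgen k (.K a) * fgen k (.E j)) (chi χ a (sroot j) • (fgen k (.E j) * fgen k (.K a)))
  | K_F (a : Fin n → ℤ) (j : Fin n) :
      DRel χ I (fgen k (.K a) * fgen k (.F j))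
        ((chi χ a (sroot j))⁻¹ • (fgen k (.F j) * fgen k (.K a)))
  | E_F (i j : Fin n) :
      DRel χ I (fgen k (.E i) * fgen k (.F j) - fgen k (.F j) * fgen k (.E i))
        (if i = j then fgen k (.K (sroot i)) - fgen k (.K (-sroot i)) else 0)
  | ideal_E (p : NCPoly k n) (hp : p ∈ I) :
      DRel χ I (FreeAlgebra.lift k (fun i => fgen k (.E i)) p) 0
  | ideal_F (p : NCPoly k n) (hp : p ∈ I) :
      DRel χ I (FreeAlgebra.lift k (fun i => fgen k (.F i)) p) 0

/-- The Drinfeld double `U(χ)` of the pre-Nichols algebra `T(V) / I`. -/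
def Double (χ : Bicharacter k n) (I : Ideal (NCPoly k n)) : Type _ := RingQuot (DRel χ I)

variable (χ : Bicharacter k n) (I : Ideal (NCPoly k n))

instance : Ring (Double χ I) := inferInstanceAs (Ring (RingQuot (DRel χ I)))

instance : Algebra k (Double χ I) := inferInstanceAs (Algebra k (RingQuot (DRel χ I)))

/-- The images of the generators in `U(χ)`. -/
def dgen (g : DGen n) : Double χ I := RingQuot.mkAlgHom k (DRel χ I) (fgen k g)

/-- The generator `E_i` of `U(χ)`. -/
def E (i : Fin n) : Double χ I := dgen χ I (.E i)

/-- The generator `F_i` of `U(χ)`. -/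
def F (i : Fin n) : Double χ I := dgen χ I (.F i)

/-- The group-like element `K_l` of `U(χ)`. -/
def K (l : Fin n → ℤ) : Double χ I := dgen χ I (.K l)

theorem K_zero : K χ I 0 = 1 :=
  (RingQuot.mkAlgHom_rel k (DRel.K_zero (χ := χ) (I := I))).trans (map_one _)

theorem K_add (a b : Fin n → ℤ) : K χ I (a + b) = K χ I a * K χ I b :=
  (RingQuot.mkAlgHom_rel k (DRel.K_add (χ := χ) (I := I) a b)).trans (map_mul _ _ _)

/-- The subalgebra `U⁺` generated by the `E_i`. -/
def Uplus : Subalgebra k (Double χ I) := Algebra.adjoin k (Set.range (E χ I))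

/-- The subalgebra `H` spanned by the `K_l`. -/
def cartan : Submodule k (Double χ I) := Submodule.span k (Set.range (K χ I))

/-- The subalgebra `G⁻` generated by the elements `F_i K_i`. -/
def Gminus : Subalgebra k (Double χ I) :=
  Algebra.adjoin k (Set.range fun i => F χ I i * K χ I (sroot i))

/-- The component `U⁺_α`, spanned by the words in the `E_i` of multidegree `a`. -/
def UplusDeg (a : Fin n → ℕ) : Submodule k (Double χ I) :=
  (homogeneous k a).map (FreeAlgebra.lift k (E χ I)).toLinearMap

/-- The component `U⁻_{-β}`, spanned by the words in the `F_i` of multidegree `b`. -/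
def UminusDeg (b : Fin n → ℕ) : Submodule k (Double χ I) :=
  (homogeneous k b).map (FreeAlgebra.lift k (F χ I)).toLinearMap

/-- The summand `U⁺ K_l G⁻` of `U(χ)`. -/
def sumP (l : Fin n → ℤ) : Submodule k (Double χ I) :=
  Subalgebra.toSubmodule (Uplus χ I) * Submodule.span k {K χ I l} *
    Subalgebra.toSubmodule (Gminus χ I)

/-- The summand `U⁺_α H U⁻_{-β}` of `U(χ)`. -/
def sumPi (ab : (Fin n → ℕ) × (Fin n → ℕ)) : Submodule k (Double χ I) :=
  UplusDeg χ I ab.1 * cartan χ I * UminusDeg χ I ab.2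

/-- The projection `P_l` onto `U⁺ K_l G⁻` along the other summands of that form. -/
def projP (l : Fin n → ℤ) : Double χ I →ₗ[k] Double χ I := componentProj (sumP χ I) l

/-- The projection `π_{α,β}` onto `U⁺_α H U⁻_{-β}` along the other summands of that form. -/
def projPi (a b : Fin n → ℕ) : Double χ I →ₗ[k] Double χ I := componentProj (sumPi χ I) (a, b)

/-- The generators `B_i = F_i + c_i E_{τ(i)} K_i⁻¹` of the coideal subalgebra. -/
def B (τ : Equiv.Perm (Fin n)) (c : Fin n → k) (i : Fin n) : Double χ I :=
  F χ I i + c i • (E χ I (τ i) * K χ I (-sroot i))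

end DrinfeldDouble

section NegativeHeisenberg

variable {k : Type*} [Field k] {n : ℕ} (χ : Bicharacter k n) (I : Ideal (NCPoly k n))
  (τ : Equiv.Perm (Fin n))

/-- Labels for the generators `E_i K_i⁻¹`, `F_i`, `K_i⁻¹`, `K_i K_{τ(i)}⁻¹` of `U(χ)^poly`. -/
inductive PolyGen (n : ℕ) : Type
  | Et (i : Fin n)
  | F (i : Fin n)
  | Kinv (i : Fin n)
  | Kth (i : Fin n)

/-- The degrees of the generators of `U(χ)^poly`. -/
def PolyGen.deg : PolyGen n → ℕ
  | .Et _ => 1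
  | .F _ => 1
  | .Kinv _ => 1
  | .Kth _ => 0

/-- The generators of `U(χ)^poly`, as elements of `U(χ)`. -/
def polyGen : PolyGen n → Double χ I
  | .Et i => E χ I i * K χ I (-sroot i)
  | .F i => F χ I i
  | .Kinv i => K χ I (-sroot i)
  | .Kth i => K χ I (sroot i) * K χ I (-sroot (τ i))

/-- The subalgebra `U(χ)^poly`. -/
def Upoly : Subalgebra k (Double χ I) := Algebra.adjoin k (Set.range (polyGen χ I τ))

/-- The generators of `U(χ)^poly`, as elements of `U(χ)^poly`. -/
def polyElt (g : PolyGen n) : Upoly χ I τ :=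
  ⟨polyGen χ I τ g, Algebra.subset_adjoin ⟨g, rfl⟩⟩

/-- The filtration of `U(χ)^poly` given by the degrees of its generators. -/
def polyFiltration : ℕ → Submodule k (Upoly χ I τ) :=
  degFiltration k (polyElt χ I τ) PolyGen.deg

instance : SetLike.GradedMonoid (polyFiltration χ I τ) :=
  degFiltration_graded (polyElt χ I τ) PolyGen.deg

theorem polyElt_mem (g : PolyGen n) : polyElt χ I τ g ∈ polyFiltration χ I τ g.deg :=
  Submodule.subset_span ⟨[g], by simp, by simp⟩

/-- The negative Heisenberg double, the associated graded algebra of `U(χ)^poly`. -/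
abbrev NegHeis : Type _ := AssocGraded (polyFiltration χ I τ)

/-- The class of a generator of `U(χ)^poly` in the negative Heisenberg double. -/
def heisGen (g : PolyGen n) : NegHeis χ I τ :=
  symb (polyFiltration χ I τ) g.deg (polyElt χ I τ g) (polyElt_mem χ I τ g)

/-- The elements `B_i^∨ = F_i + c_i Ẽ_{τ(i)} (K_{τ(i)} K_i⁻¹)` of the negative Heisenberg double,
for an involution `τ`. -/
def Bvee (c : Fin n → k) (i : Fin n) : NegHeis χ I τ :=
  heisGen χ I τ (.F i) + c i • (heisGen χ I τ (.Et (τ i)) * heisGen χ I τ (.Kth (τ i)))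

/-- The automorphism of `ℤ^n` with `τ(α_i) = α_{τ(i)}`. -/
def permWeight (l : Fin n → ℤ) : Fin n → ℤ := fun i => l (τ.symm i)

/-- The lattice `ℤ^n_θ` of weights fixed by `θ = -τ`. -/
def thetaFixed : AddSubgroup (Fin n → ℤ) where
  carrier := {l | -permWeight τ l = l}
  zero_mem' := by funext i; simp [permWeight]
  add_mem' := by
    intro a b ha hb
    funext i
    have h1 := congrFun ha i
    have h2 := congrFun hb i
    simp only [permWeight, Pi.neg_apply, Pi.add_apply] at *
    omega
  neg_mem' := by
    intro a ha
    funext i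
    have h1 := congrFun ha i
    simp only [permWeight, Pi.neg_apply] at *
    omega

/-- The monoid of weights `-ℕ^n + ℤ^n_θ`. -/
def polyWeights : AddSubmonoid (Fin n → ℤ) where
  carrier := {l | ∃ b : Fin n → ℕ, ∃ m ∈ thetaFixed τ, l = -(fun i => (b i : ℤ)) + m}
  zero_mem' := ⟨0, 0, (thetaFixed τ).zero_mem, by funext i; simp⟩
  add_mem' := by
    rintro _ _ ⟨b, m, hm, rfl⟩ ⟨b', m', hm', rfl⟩
    refine ⟨b + b', m + m', (thetaFixed τ).add_mem hm hm', ?_⟩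
    funext i
    simp only [Pi.add_apply, Pi.neg_apply, Nat.cast_add]
    ring

/-- The weights `l` for which `K_l` is a product of generators of `U(χ)^poly` of total degree
`-(l_1 + ... + l_n)`. -/
def goodWeights : AddSubmonoid (Fin n → ℤ) where
  carrier := {l | ∃ w : List (PolyGen n), (((w.map PolyGen.deg).sum : ℕ) : ℤ) = -∑ i, l i ∧
    (w.map (polyGen χ I τ)).prod = K χ I l}
  zero_mem' := ⟨[], by simp, by simp [K_zero]⟩
  add_mem' := by
    rintro a b ⟨v, hv, hv'⟩ ⟨w, hw, hw'⟩
    refine ⟨v ++ w, ?_, ?_⟩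
    · simp only [List.map_append, List.sum_append, Nat.cast_add, hv, hw, Pi.add_apply,
        Finset.sum_add_distrib]
      ring
    · rw [List.map_append, List.prod_append, hv', hw', K_add]

theorem polyWeights_le : polyWeights τ ≤ goodWeights χ I τ := by
  have h1 : ∀ i, -sroot i ∈ goodWeights χ I τ := fun i =>
    ⟨[.Kinv i], by simp [PolyGen.deg, sroot], by simp [polyGen]⟩
  have h2 : ∀ i, sroot i + -sroot (τ i) ∈ goodWeights χ I τ := fun i =>
    ⟨[.Kth i], by simp [PolyGen.deg, sroot, Finset.sum_add_distrib], by simp [polyGen, K_add]⟩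
  rintro _ ⟨b, m, hm, rfl⟩
  have h3 : -(fun i => (b i : ℤ)) + m = ∑ i, b i • (-sroot i) +
      ∑ i, (m i).toNat • (sroot i + -sroot (τ i)) := by
    funext j
    have hj := congrFun hm j
    simp only [permWeight, Pi.neg_apply] at hj
    have e1 : ∀ i, (sroot i : Fin n → ℤ) j = if i = j then 1 else 0 := fun i => by
      simp [sroot, Pi.single_apply, eq_comm]
    have e2 : ∀ i, (sroot (τ i) : Fin n → ℤ) j = if i = τ.symm j then 1 else 0 := fun i => by
      simp [sroot, Pi.single_apply, Equiv.eq_symm_apply, eq_comm]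
    simp only [Pi.add_apply, Pi.neg_apply, Finset.sum_apply, Pi.smul_apply, e2]
    simp only [e1, smul_add, Finset.sum_add_distrib, smul_neg, Finset.sum_neg_distrib, nsmul_eq_mul,
      mul_ite, mul_one, mul_zero, Finset.sum_ite_eq', Finset.mem_univ, if_true]
    omega
  rw [h3]
  exact add_mem (sum_mem fun i _ => nsmul_mem (h1 i) _) (sum_mem fun i _ => nsmul_mem (h2 i) _)

/-- The filtration degree `-(l_1 + ... + l_n)` of `K_l`. -/
def weightDegree (l : Fin n → ℤ) : ℕ := (-∑ i, l i).toNat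

theorem K_mem_Upoly {l : Fin n → ℤ} (hl : l ∈ polyWeights τ) : K χ I l ∈ Upoly χ I τ := by
  obtain ⟨w, -, hw⟩ := polyWeights_le χ I τ hl
  rw [← hw]
  refine list_prod_mem fun x hx => ?_
  obtain ⟨g, -, rfl⟩ := List.mem_map.1 hx
  exact (polyElt χ I τ g).2

theorem weightDegree_add {a b : Fin n → ℤ} (ha : a ∈ polyWeights τ) (hb : b ∈ polyWeights τ) :
    weightDegree (a + b) = weightDegree a + weightDegree b := by
  obtain ⟨v, hv, -⟩ := polyWeights_le (k := ℚ) 0 ⊥ τ ha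
  obtain ⟨w, hw, -⟩ := polyWeights_le (k := ℚ) 0 ⊥ τ hb
  simp only [weightDegree, Pi.add_apply, Finset.sum_add_distrib]
  omega

/-- `K_l` as an element of `U(χ)^poly`, for `l ∈ -ℕ^n + ℤ^n_θ`. -/
def polyK (l : polyWeights τ) : Upoly χ I τ := ⟨K χ I l, K_mem_Upoly χ I τ l.2⟩

theorem polyK_mem (l : polyWeights τ) :
    polyK χ I τ l ∈ polyFiltration χ I τ (weightDegree (l : Fin n → ℤ)) := by
  obtain ⟨w, hd, hw⟩ := polyWeights_le χ I τ l.2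
  refine Submodule.subset_span ⟨w, ?_, ?_⟩
  · simp only [weightDegree]
    omega
  · apply Subtype.ext
    change (Upoly χ I τ).val _ = _
    rw [map_list_prod, List.map_map]
    exact hw

/-- The algebra homomorphism `k[K_l | l ∈ -ℕ^n + ℤ^n_θ] → U(χ)^poly`. -/
def torusToPoly : AddMonoidAlgebra k (polyWeights τ) →ₐ[k] Upoly χ I τ :=
  AddMonoidAlgebra.lift k (Upoly χ I τ) (polyWeights τ)
    { toFun := fun l => polyK χ I τ l.toAdd
      map_one' := Subtype.ext (K_zero χ I)
      map_mul' := fun a b => Subtype.ext (K_add χ I a.toAdd b.toAdd) }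

/-- The algebra homomorphism `k[K_l | l ∈ -ℕ^n + ℤ^n_θ] → Heis(χ)^∨`; it sends `K_l` to its class in
degree `-(l_1 + ... + l_n)`. -/
def torusToHeis : AddMonoidAlgebra k (polyWeights τ) →ₐ[k] NegHeis χ I τ :=
  AddMonoidAlgebra.lift k (NegHeis χ I τ) (polyWeights τ)
    { toFun := fun l =>
        symb (polyFiltration χ I τ) (weightDegree (l.toAdd : Fin n → ℤ)) (polyK χ I τ l.toAdd)
          (polyK_mem χ I τ l.toAdd)
      map_one' := symb_congr _ _ SetLike.GradedOne.one_mem (by simp [weightDegree])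
        (Subtype.ext (K_zero χ I))
      map_mul' := fun a b => by
        rw [symb_mul]
        exact symb_congr _ _ _ (weightDegree_add τ a.toAdd.2 b.toAdd.2)
          (Subtype.ext (K_add χ I a.toAdd b.toAdd)) }

/-- The augmentation ideal of the subalgebra `G⁺` of the negative Heisenberg double generated by the
classes of the `E_i K_i⁻¹`: the span of the nonempty words. -/
def augGplus : Submodule k (NegHeis χ I τ) :=
  Submodule.span k {x | ∃ w : List (Fin n), w ≠ [] ∧
    (w.map fun i => heisGen χ I τ (.Et i)).prod = x}

/-- The augmentation ideal of the subalgebra `U⁻` of the negative Heisenberg double generated by the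
classes of the `F_i`: the span of the nonempty words. -/
def augUminus : Submodule k (NegHeis χ I τ) :=
  Submodule.span k {x | ∃ w : List (Fin n), w ≠ [] ∧
    (w.map fun i => heisGen χ I τ (.F i)).prod = x}

/-- The subalgebra `k[K_l | l ∈ -ℕ^n + ℤ^n_θ]` of the negative Heisenberg double. -/
def heisTorus : Submodule k (NegHeis χ I τ) := LinearMap.range (torusToHeis χ I τ).toLinearMap

/-- The subspace `G⁺_+ Heis(χ)^∨ + Heis(χ)^∨ U⁻_+` of the negative Heisenberg double. -/
def heisComplement : Submodule k (NegHeis χ I τ) :=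
  augGplus χ I τ * ⊤ ⊔ ⊤ * augUminus χ I τ

/-- The projection `π^∨_{0,0}` of the negative Heisenberg double onto its subalgebra
`k[K_l | l ∈ -ℕ^n + ℤ^n_θ]`. -/
def projPiVee : NegHeis χ I τ →ₗ[k] NegHeis χ I τ :=
  projAlong (heisTorus χ I τ) (heisComplement χ I τ)

end NegativeHeisenberg

end QuantumDouble

end

open QuantumDouble

/-! Everything rests on the triangular decomposition of `U(χ)` as `T(V)/I ⊗ k[ℤ^n] ⊗ T(V)/I`.
Commuting `F_j` to the right shows that the normally ordered monomials `E_w K_m F_v` span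
(`nfSpan_univ`). There are no hidden relations among them, because `U(χ)` acts on the tensor product
by the formulas that left multiplication would have to satisfy (`rep`), and `E_w K_m F_v` sends `1 ⊗
1 ⊗ 1` to the tensor of its three parts (`toTriangular_nf`). The delicate relation is `p(F) = 0` for
`p ∈ I`. The commutator of `E_i` with `p(F)` is given by the left and right skew derivatives of `p`
(`mul_lift_eq_lift_mul_add_derivations`), and these stay in `I` because `I` is a coideal in tensor
degrees at least two (`IsGradedBiideal.leftDer_mem`, `IsGradedBiideal.rightDer_mem`).

So `U(χ)` is the direct sum, as a vector space, of pieces indexed by the triples (content of `w`,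
`m`, content of `v`), and both decompositions in (1) are coarsenings of it (`sumP_eq`, `sumPi_eq`).
In either order, `π_{0,0}` and `P_m` together read off the coefficient of `K_m` (`projPi_projP`,
`projP_projPi`).

For the Heisenberg double, an element of filtration step `m` involves only those `K_l` with `-∑ l_i
≤ m` (`polyFiltration_le`). The coefficients with equality vanish on lower steps and define a map
`heisCoeff` on the associated graded algebra. It kills the complement in (3) and recovers the
coefficients of elements of the torus algebra, which yields (3), injectivity of (2) and a formula
for `π^∨_{0,0}` (`projPiVee_eq`).

To compare both sides for `p` of multidegree `λ`: every `K_m` occurring in `p(B)` satisfies `m ≥ -λ`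
coordinatewise (`lift_B_mem`). Since `B_i^∨` is the degree one symbol of `B_i`, the Heisenberg side
sees the `K_m` whose coordinate sum is that of `-λ` (`heisCoeff_lift_Bvee`). The two conditions
force `m = -λ`, which is what `P_{-λ}` selects (`degreePart_torusCoeff`). For the vanishing, let a
term use the `E` summands of the `B_i` with multidegree `a` and the `F` summands with multidegree
`b`, so `a + b = λ`. Normal ordering cancels `E_j` only against `F_j`, so a pure `K_m` can remain
only if `b = τ(a)`, whence `λ = a + τ(a)` (`torusCoeff_eq_zero_of_notMem`). -/

noncomputable section

namespace QuantumDouble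

open TensorProduct

/-! ### Multidegrees and weights of words. -/

section Words

variable {n : ℕ}

/-- The multidegree of a word. -/
def content (w : List (Fin n)) : Fin n → ℕ := fun i => w.count i

/-- The inclusion `ℕ^n → ℤ^n`. -/
def toInt : (Fin n → ℕ) →+ (Fin n → ℤ) where
  toFun a := fun i => a i
  map_zero' := by ext; simp
  map_add' a b := by ext; simp

theorem toInt_apply (a : Fin n → ℕ) (i : Fin n) : toInt a i = a i := rfl

/-- The weight of a word. -/
def wt (w : List (Fin n)) : Fin n → ℤ := toInt (content w)

theorem content_nil : content ([] : List (Fin n)) = 0 := by ext; simp [content]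

theorem content_cons (i : Fin n) (w : List (Fin n)) :
    content (i :: w) = content w + Pi.single i 1 := by
  ext j
  by_cases h : j = i
  · subst h; simp [content]
  · simp [content, List.count_cons_of_ne (Ne.symm h), h]

theorem content_eq_zero {w : List (Fin n)} : content w = 0 ↔ w = [] := by
  refine ⟨fun h => ?_, fun h => h ▸ content_nil⟩
  refine List.eq_nil_iff_forall_not_mem.2 fun i hi => ?_
  have := congrFun h i
  simp only [content, Pi.zero_apply, List.count_eq_zero] at this
  exact this hi

theorem toInt_single (i : Fin n) : toInt (Pi.single i 1) = sroot i := by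
  ext j
  by_cases h : j = i
  · subst h; simp [toInt_apply, sroot]
  · simp [toInt_apply, sroot, h]

theorem wt_nil : wt ([] : List (Fin n)) = 0 := by simp [wt, content_nil]

theorem wt_cons (i : Fin n) (w : List (Fin n)) : wt (i :: w) = sroot i + wt w := by
  rw [wt, content_cons, map_add, toInt_single, add_comm, wt]

theorem sum_sroot (i : Fin n) : ∑ j, sroot i j = 1 := by simp [sroot]

theorem sum_wt (w : List (Fin n)) : ∑ j, wt w j = w.length := by
  induction w with
  | nil => simp [wt_nil]
  | cons i w ih => simp [wt_cons, Finset.sum_add_distrib, ih, sum_sroot, add_comm]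

end Words

/-! ### Bicharacter identities. -/

section Characters

variable {k : Type*} [Field k] {n : ℕ} (χ : Bicharacter k n)

theorem chi_zero_left (b : Fin n → ℤ) : chi χ 0 b = 1 := by simp [chi]

theorem chi_zero_right (a : Fin n → ℤ) : chi χ a 0 = 1 := by simp [chi]

theorem chi_add_left (a a' b : Fin n → ℤ) : chi χ (a + a') b = chi χ a b * chi χ a' b := by
  simp [chi]

theorem chi_add_right (a b b' : Fin n → ℤ) : chi χ a (b + b') = chi χ a b * chi χ a b' := by
  simp [chi]

theorem chi_neg_left (a b : Fin n → ℤ) : chi χ (-a) b = (chi χ a b)⁻¹ := by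
  simp [chi]

theorem chi_ne_zero (a b : Fin n → ℤ) : chi χ a b ≠ 0 := Units.ne_zero _

end Characters

/-! ### The word basis of the tensor algebra. -/

section TensorAlgebra

variable (k : Type*) [Field k] {n : ℕ}

theorem monomialOf_nil : monomialOf k ([] : List (Fin n)) = 1 := rfl

theorem monomialOf_cons (i : Fin n) (w : List (Fin n)) :
    monomialOf k (i :: w) = FreeAlgebra.ι k i * monomialOf k w := by
  simp [monomialOf]

theorem lift_monomialOf {R : Type*} [Semiring R] [Algebra k R] (f : Fin n → R) (w : List (Fin n)) :
    FreeAlgebra.lift k f (monomialOf k w) = (w.map f).prod := by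
  simp only [monomialOf, map_list_prod, List.map_map]
  congr 1
  refine List.map_congr_left fun i _ => ?_
  simp

theorem basis_eq_monomialOf (w : List (Fin n)) :
    FreeAlgebra.basisFreeMonoid k (Fin n) (FreeMonoid.ofList w) = monomialOf k w := by
  have h : FreeAlgebra.lift k (fun x => MonoidAlgebra.of k (FreeMonoid (Fin n)) (.of x))
      (monomialOf k w) = MonoidAlgebra.of k _ (FreeMonoid.ofList w) := by
    induction w with
    | nil => exact map_one _
    | cons i w ih =>
      rw [monomialOf_cons, map_mul, ih, FreeAlgebra.lift_ι_apply, ← map_mul]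
      rfl
  apply (FreeAlgebra.basisFreeMonoid k (Fin n)).repr.injective
  rw [Module.Basis.repr_self]
  exact (congrArg (MonoidAlgebra.coeffLinearEquiv k) h).symm

theorem nc_induction {P : NCPoly k n → Prop} (hm : ∀ w, P (monomialOf k w))
    (ha : ∀ p q, P p → P q → P (p + q)) (hs : ∀ (r : k) p, P p → P (r • p)) (p : NCPoly k n) :
    P p := by
  have h : p ∈ Submodule.span k (Set.range (FreeAlgebra.basisFreeMonoid k (Fin n))) := by
    rw [Module.Basis.span_eq]; trivial
  induction h using Submodule.span_induction with
  | mem x hx =>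
    obtain ⟨w, rfl⟩ := hx
    have := hm (FreeMonoid.toList w)
    rwa [← basis_eq_monomialOf] at this
  | zero => simpa using hs 0 _ (hm [])
  | add x y _ _ hx hy => exact ha _ _ hx hy
  | smul r x _ hx => exact hs _ _ hx

variable {k}

theorem nc_ext {N : Type*} [AddCommGroup N] [Module k N] {f g : NCPoly k n →ₗ[k] N}
    (h : ∀ w, f (monomialOf k w) = g (monomialOf k w)) : f = g := by
  refine LinearMap.ext fun p => ?_
  induction p using nc_induction k with
  | hm w => exact h w
  | ha p q hp hq => rw [map_add, map_add, hp, hq]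
  | hs r p hp => rw [map_smul, map_smul, hp]

/-- The linear functional that reads off the coefficient of a word. -/
def coeff (w : List (Fin n)) : NCPoly k n →ₗ[k] k :=
  (FreeAlgebra.basisFreeMonoid k (Fin n)).coord (FreeMonoid.ofList w)

theorem coeff_monomialOf (v w : List (Fin n)) :
    coeff w (monomialOf k v) = if v = w then 1 else 0 := by
  rw [coeff, ← basis_eq_monomialOf, Module.Basis.coord_apply, Module.Basis.repr_self,
    Finsupp.single_apply_left FreeMonoid.ofList.injective, Finsupp.single_apply]

theorem coeff_one (w : List (Fin n)) :
    coeff w (1 : NCPoly k n) = if w = [] then 1 else 0 := by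
  rw [← monomialOf_nil, coeff_monomialOf]
  simp only [eq_comm]

theorem coeff_nil_mul (i : Fin n) (p : NCPoly k n) : coeff [] (FreeAlgebra.ι k i * p) = 0 := by
  have : (coeff []).comp (LinearMap.mulLeft k (FreeAlgebra.ι k i)) = 0 := nc_ext fun w => by
    simp [← monomialOf_cons, coeff_monomialOf]
  exact LinearMap.congr_fun this p

/-- A one-letter word beginning with `x_i` is `x_i` times the empty word. This is how the counit
enters the Leibniz rules for the skew derivations. -/
theorem coeff_singleton_mul (i j : Fin n) (p : NCPoly k n) :
    coeff [j] (FreeAlgebra.ι k i * p) = if i = j then coeff [] p else 0 := by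
  have : (coeff [j]).comp (LinearMap.mulLeft k (FreeAlgebra.ι k i)) =
      (if i = j then coeff [] else 0) := nc_ext fun w => by
    by_cases h : i = j <;> simp [← monomialOf_cons, coeff_monomialOf, h]
  refine (LinearMap.congr_fun this p).trans ?_
  split_ifs <;> rfl

/-- The projection of the tensor algebra onto a homogeneous component. -/
def homProj (a : Fin n → ℕ) : NCPoly k n →ₗ[k] NCPoly k n :=
  (FreeAlgebra.basisFreeMonoid k (Fin n)).constr k fun w =>
    if content (FreeMonoid.toList w) = a then monomialOf k (FreeMonoid.toList w) else 0

theorem homProj_monomialOf (a : Fin n → ℕ) (w : List (Fin n)) :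
    homProj a (monomialOf k w) = if content w = a then monomialOf k w else 0 := by
  rw [homProj, ← basis_eq_monomialOf, Module.Basis.constr_basis]
  simp only [FreeMonoid.toList_ofList, basis_eq_monomialOf]
  rfl

theorem mem_homogeneous_induction {l : Fin n → ℕ} {P : NCPoly k n → Prop}
    (hm : ∀ w, content w = l → P (monomialOf k w))
    (ha : ∀ p q, P p → P q → P (p + q)) (h0 : P 0) (hs : ∀ (r : k) p, P p → P (r • p))
    {p : NCPoly k n} (hp : p ∈ homogeneous k l) : P p := by
  induction hp using Submodule.span_induction with
  | mem x hx =>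
    obtain ⟨w, hw, rfl⟩ := hx
    exact hm w (funext hw)
  | zero => exact h0
  | add x y _ _ hx hy => exact ha _ _ hx hy
  | smul r x _ hx => exact hs _ _ hx

end TensorAlgebra

/-! ### Skew derivations and the stability of a graded biideal under them. -/

section Biideal

variable {k : Type*} [Field k] {n : ℕ} (χ : Bicharacter k n)

/-- The action of the group-like `K_l` on the tensor algebra. -/
def weightAct (l : Fin n → ℤ) : NCPoly k n →ₐ[k] NCPoly k n :=
  FreeAlgebra.lift k fun j => chi χ l (sroot j) • FreeAlgebra.ι k j

theorem weightAct_sroot (i : Fin n) : weightAct χ (sroot i) = groupAct χ i := rfl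

theorem weightAct_ι (l : Fin n → ℤ) (j : Fin n) :
    weightAct χ l (FreeAlgebra.ι k j) = chi χ l (sroot j) • FreeAlgebra.ι k j := by
  simp [weightAct]

theorem weightAct_monomialOf (l : Fin n → ℤ) (w : List (Fin n)) :
    weightAct χ l (monomialOf k w) = chi χ l (wt w) • monomialOf k w := by
  induction w with
  | nil => simp [monomialOf_nil, wt_nil, chi_zero_right]
  | cons i w ih =>
    rw [monomialOf_cons, map_mul, weightAct_ι, ih, wt_cons, chi_add_right, smul_mul_smul_comm]

theorem weightAct_add (a b : Fin n → ℤ) (p : NCPoly k n) :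
    weightAct χ (a + b) p = weightAct χ a (weightAct χ b p) := by
  have : (weightAct χ (a + b)).toLinearMap =
      (weightAct χ a).toLinearMap.comp (weightAct χ b).toLinearMap := nc_ext fun w => by
    simp [weightAct_monomialOf, chi_add_left, smul_smul, mul_comm]
  exact LinearMap.congr_fun this p

theorem weightAct_zero (p : NCPoly k n) : weightAct χ 0 p = p := by
  have : (weightAct χ 0).toLinearMap = LinearMap.id := nc_ext fun w => by
    simp [weightAct_monomialOf, chi_zero_left]
  exact LinearMap.congr_fun this p

theorem coeff_nil_weightAct (l : Fin n → ℤ) (p : NCPoly k n) :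
    coeff [] (weightAct χ l p) = coeff [] p := by
  have : (coeff []).comp (weightAct χ l).toLinearMap = coeff [] := nc_ext fun w => by
    by_cases h : w = [] <;>
      simp [weightAct_monomialOf, coeff_monomialOf, h, wt_nil, chi_zero_right]
  exact LinearMap.congr_fun this p

theorem coeff_singleton_weightAct (l : Fin n → ℤ) (j : Fin n) (p : NCPoly k n) :
    coeff [j] (weightAct χ l p) = chi χ l (sroot j) * coeff [j] p := by
  have : (coeff [j]).comp (weightAct χ l).toLinearMap = chi χ l (sroot j) • coeff [j] :=
    nc_ext fun w => by
      by_cases h : w = [j]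
      · simp [weightAct_monomialOf, coeff_monomialOf, h, wt_nil, wt_cons]
      · simp [weightAct_monomialOf, coeff_monomialOf, h]
  exact LinearMap.congr_fun this p

/-- The skew derivation that splits off the letter `x_j` on the left of the braided coproduct. -/
def leftDer (j : Fin n) : NCPoly k n →ₗ[k] NCPoly k n :=
  (TensorProduct.lid k (NCPoly k n)).toLinearMap ∘ₗ
    TensorProduct.map (coeff [j]) LinearMap.id ∘ₗ braidedCoproduct χ

/-- The skew derivation that splits off the letter `x_j` on the right of the braided coproduct. -/
def rightDer (j : Fin n) : NCPoly k n →ₗ[k] NCPoly k n :=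
  (TensorProduct.rid k (NCPoly k n)).toLinearMap ∘ₗ
    TensorProduct.map LinearMap.id (coeff [j]) ∘ₗ braidedCoproduct χ

theorem braidedCoproduct_one : braidedCoproduct χ 1 = 1 ⊗ₜ 1 := by
  simp [braidedCoproduct]

theorem braidedCoproduct_mul (i : Fin n) (p : NCPoly k n) :
    braidedCoproduct χ (FreeAlgebra.ι k i * p) = braidedLeftMul χ i (braidedCoproduct χ p) := by
  simp [braidedCoproduct]

/-- The coefficient of the empty word is the counit; this is one half of the counit axiom for the
braided coproduct. -/
theorem braidedCoproduct_counit_left (p : NCPoly k n) :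
    TensorProduct.lid k _ (TensorProduct.map (coeff []) LinearMap.id (braidedCoproduct χ p)) =
      p := by
  -- The recursion is proved for arbitrary tensors, not only for coproducts, so that it can be
  -- checked on pure tensors.
  have key : ∀ i (z : NCPoly k n ⊗[k] NCPoly k n),
      TensorProduct.lid k _ (TensorProduct.map (coeff []) LinearMap.id (braidedLeftMul χ i z)) =
        FreeAlgebra.ι k i *
          TensorProduct.lid k _ (TensorProduct.map (coeff []) LinearMap.id z) := by
    intro i z
    induction z with
    | zero => simp
    | add x y hx hy => simp only [map_add, hx, hy, mul_add]
    | tmul a b =>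
      simp [braidedLeftMul, coeff_nil_mul, ← weightAct_sroot, coeff_nil_weightAct]
  induction p using nc_induction k with
  | hm w =>
    induction w with
    | nil => simp [monomialOf_nil, braidedCoproduct_one, coeff_one]
    | cons i w ih => rw [monomialOf_cons, braidedCoproduct_mul, key, ih]
  | ha p q hp hq => rw [map_add, map_add, map_add, hp, hq]
  | hs r p hp => rw [map_smul, map_smul, map_smul, hp]

theorem braidedCoproduct_counit_right (p : NCPoly k n) :
    TensorProduct.rid k _ (TensorProduct.map LinearMap.id (coeff []) (braidedCoproduct χ p)) =
      p := by
  have key : ∀ i (z : NCPoly k n ⊗[k] NCPoly k n),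
      TensorProduct.rid k _ (TensorProduct.map LinearMap.id (coeff []) (braidedLeftMul χ i z)) =
        FreeAlgebra.ι k i *
          TensorProduct.rid k _ (TensorProduct.map LinearMap.id (coeff []) z) := by
    intro i z
    induction z with
    | zero => simp
    | add x y hx hy => simp only [map_add, hx, hy, mul_add]
    | tmul a b => simp [braidedLeftMul, coeff_nil_mul]
  induction p using nc_induction k with
  | hm w =>
    induction w with
    | nil => simp [monomialOf_nil, braidedCoproduct_one, coeff_one]
    | cons i w ih => rw [monomialOf_cons, braidedCoproduct_mul, key, ih]
  | ha p q hp hq => rw [map_add, map_add, map_add, hp, hq]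
  | hs r p hp => rw [map_smul, map_smul, map_smul, hp]

theorem leftDer_one (j : Fin n) : leftDer χ j 1 = 0 := by
  simp [leftDer, braidedCoproduct_one, coeff_one]

theorem rightDer_one (j : Fin n) : rightDer χ j 1 = 0 := by
  simp [rightDer, braidedCoproduct_one, coeff_one]

/-- Leibniz rule: `x_i ⊗ 1` contributes only through the counit, while `1 ⊗ x_i` passes the
split-off letter `x_j` at the cost of `q_ij`. -/
theorem leftDer_mul (i j : Fin n) (p : NCPoly k n) :
    leftDer χ j (FreeAlgebra.ι k i * p) =
      (if i = j then p else 0) + qmat χ i j • (FreeAlgebra.ι k i * leftDer χ j p) := by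
  have key : ∀ z : NCPoly k n ⊗[k] NCPoly k n,
      TensorProduct.lid k _ (TensorProduct.map (coeff [j]) LinearMap.id (braidedLeftMul χ i z)) =
        (if i = j then TensorProduct.lid k _ (TensorProduct.map (coeff []) LinearMap.id z) else 0) +
        qmat χ i j • (FreeAlgebra.ι k i *
          TensorProduct.lid k _ (TensorProduct.map (coeff [j]) LinearMap.id z)) := by
    intro z
    induction z with
    | zero => simp
    | add x y hx hy =>
      simp only [map_add, hx, hy, mul_add, smul_add]
      split_ifs <;> abel
    | tmul a b =>
      simp only [braidedLeftMul, LinearMap.add_apply, TensorProduct.map_tmul, map_add,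
        LinearMap.mulLeft_apply, LinearMap.id_apply, TensorProduct.lid_tmul, coeff_singleton_mul,
        ← weightAct_sroot, AlgHom.toLinearMap_apply, coeff_singleton_weightAct, mul_smul_comm,
        smul_smul, qmat]
      split_ifs <;> simp
  have h := key (braidedCoproduct χ p)
  rw [braidedCoproduct_counit_left, ← braidedCoproduct_mul] at h
  exact h

/-- Leibniz rule on the other side: here `1 ⊗ x_i` contributes through the counit, and the braiding
makes `K_i` act on all of the left factor. -/
theorem rightDer_mul (i j : Fin n) (p : NCPoly k n) :
    rightDer χ j (FreeAlgebra.ι k i * p) =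
      FreeAlgebra.ι k i * rightDer χ j p + (if i = j then weightAct χ (sroot i) p else 0) := by
  have key : ∀ z : NCPoly k n ⊗[k] NCPoly k n,
      TensorProduct.rid k _ (TensorProduct.map LinearMap.id (coeff [j]) (braidedLeftMul χ i z)) =
        FreeAlgebra.ι k i *
          TensorProduct.rid k _ (TensorProduct.map LinearMap.id (coeff [j]) z) +
        (if i = j then weightAct χ (sroot i)
          (TensorProduct.rid k _ (TensorProduct.map LinearMap.id (coeff []) z)) else 0) := by
    intro z
    induction z with
    | zero => simp
    | add x y hx hy =>
      simp only [map_add, hx, hy, mul_add]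
      split_ifs <;> abel
    | tmul a b =>
      simp only [braidedLeftMul, LinearMap.add_apply, TensorProduct.map_tmul, map_add,
        LinearMap.mulLeft_apply, LinearMap.id_apply, TensorProduct.rid_tmul, coeff_singleton_mul,
        ← weightAct_sroot, AlgHom.toLinearMap_apply, mul_smul_comm]
      split_ifs <;> simp
  have h := key (braidedCoproduct χ p)
  rw [braidedCoproduct_counit_right, ← braidedCoproduct_mul] at h
  exact h

theorem leftDer_weightAct (l : Fin n → ℤ) (j : Fin n) (p : NCPoly k n) :
    leftDer χ j (weightAct χ l p) = chi χ l (sroot j) • weightAct χ l (leftDer χ j p) := by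
  induction p using nc_induction k with
  | hm w =>
    induction w with
    | nil => simp [monomialOf_nil, leftDer_one]
    | cons i w ih =>
      rw [monomialOf_cons, map_mul, weightAct_ι, smul_mul_assoc, map_smul, leftDer_mul, ih,
        leftDer_mul, map_add, map_smul, map_mul, weightAct_ι]
      split_ifs with h
      · subst h
        simp only [smul_add, mul_smul_comm, smul_mul_assoc, smul_smul]
      · simp only [mul_smul_comm, smul_mul_assoc, smul_smul, map_zero, zero_add]
        congr 1
        ring
  | ha p q hp hq => simp only [map_add, hp, hq, smul_add]
  | hs r p hp => simp only [map_smul, hp]; rw [smul_comm]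

theorem rightDer_weightAct (l : Fin n → ℤ) (j : Fin n) (p : NCPoly k n) :
    rightDer χ j (weightAct χ l p) = chi χ l (sroot j) • weightAct χ l (rightDer χ j p) := by
  induction p using nc_induction k with
  | hm w =>
    induction w with
    | nil => simp [monomialOf_nil, rightDer_one]
    | cons i w ih =>
      rw [monomialOf_cons, map_mul, weightAct_ι, smul_mul_assoc, map_smul, rightDer_mul, ih,
        rightDer_mul, map_add, map_mul, weightAct_ι]
      split_ifs with h
      · subst h
        simp only [smul_add, mul_smul_comm, smul_mul_assoc, smul_smul, ← weightAct_add, add_comm]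
      · simp only [mul_smul_comm, smul_mul_assoc, smul_smul, map_zero, add_zero, mul_comm]
  | ha p q hp hq => simp only [map_add, hp, hq, smul_add]
  | hs r p hp => simp only [map_smul, hp]; rw [smul_comm]

variable {χ} {I : Ideal (NCPoly k n)}

/-- A graded ideal is spanned by its homogeneous elements, on each of which such an operator is a
scalar. Both the torus action and the projections to multidegrees are of this kind. -/
theorem IsGradedBiideal.map_mem_of_scalar (hI : IsGradedBiideal χ I)
    {f : NCPoly k n →ₗ[k] NCPoly k n}
    (s : (Fin n → ℕ) → k) (hf : ∀ w, f (monomialOf k w) = s (content w) • monomialOf k w)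
    {p : NCPoly k n} (hp : p ∈ I) : f p ∈ I := by
  have h : (⨆ l : Fin n → ℕ, (I.restrictScalars k ⊓ homogeneous k l)) ≤
      (I.restrictScalars k).comap f := by
    refine iSup_le fun l x hx => ?_
    have hx2 : f x = s l • x := by
      refine mem_homogeneous_induction (P := fun x => f x = s l • x) ?_ ?_ ?_ ?_ hx.2
      · rintro w rfl; exact hf w
      · intro p q hp hq; rw [map_add, hp, hq, smul_add]
      · simp
      · intro r p hp; rw [map_smul, hp, smul_comm]
    rw [Submodule.mem_comap, hx2]
    exact Submodule.smul_mem _ _ hx.1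
  exact h (hI.graded p hp)

theorem IsGradedBiideal.weightAct_mem (hI : IsGradedBiideal χ I) (l : Fin n → ℤ)
    {p : NCPoly k n} (hp : p ∈ I) :
    weightAct χ l p ∈ I :=
  hI.map_mem_of_scalar (f := (weightAct χ l).toLinearMap) (fun a => chi χ l (toInt a))
    (fun w => weightAct_monomialOf χ l w) hp

theorem IsGradedBiideal.homProj_mem (hI : IsGradedBiideal χ I) (a : Fin n → ℕ)
    {p : NCPoly k n} (hp : p ∈ I) :
    homProj a p ∈ I := by
  exact hI.map_mem_of_scalar (fun b => if b = a then 1 else 0)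
    (fun w => by rw [homProj_monomialOf]; split_ifs <;> simp) hp

theorem IsGradedBiideal.coeff_eq_zero (hI : IsGradedBiideal χ I) {w : List (Fin n)}
    (hw : w.length < 2)
    {p : NCPoly k n}
    (hp : p ∈ I) : coeff w p = 0 := by
  have h : degreeAtLeastTwo k n ≤ LinearMap.ker (coeff w) := by
    refine Submodule.span_le.2 ?_
    rintro _ ⟨v, hv, rfl⟩
    have : v ≠ w := by rintro rfl; omega
    simp [coeff_monomialOf, this]
  exact h (hI.degree hp)

/-- The coproduct of `p` lies in `I ⊗ T(V) + T(V) ⊗ I`. Taking the coefficient of `x_j` on the left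
kills the first summand, as `I` has no elements of degree one, and sends the second into `I`. -/
theorem IsGradedBiideal.leftDer_mem (hI : IsGradedBiideal χ I) (j : Fin n)
    {p : NCPoly k n} (hp : p ∈ I) :
    leftDer χ j p ∈ I := by
  have h := hI.coideal p hp
  suffices h2 : LinearMap.range (TensorProduct.map (I.restrictScalars k).subtype
        (LinearMap.id : NCPoly k n →ₗ[k] NCPoly k n)) ⊔
      LinearMap.range (TensorProduct.map (LinearMap.id : NCPoly k n →ₗ[k] NCPoly k n)
        (I.restrictScalars k).subtype) ≤ (I.restrictScalars k).comap
        ((TensorProduct.lid k (NCPoly k n)).toLinearMap ∘ₗ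
          TensorProduct.map (coeff [j]) LinearMap.id) from h2 h
  refine sup_le ?_ ?_
  · rintro _ ⟨z, rfl⟩
    induction z with
    | zero => simp
    | add x y hx hy => rw [map_add]; exact add_mem hx hy
    | tmul a b =>
      have := hI.coeff_eq_zero (w := [j]) (by simp) a.2
      simp [this]
  · rintro _ ⟨z, rfl⟩
    induction z with
    | zero => simp
    | add x y hx hy => rw [map_add]; exact add_mem hx hy
    | tmul a b =>
      simpa using (I.restrictScalars k).smul_mem (coeff [j] a) b.2

theorem IsGradedBiideal.rightDer_mem (hI : IsGradedBiideal χ I) (j : Fin n)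
    {p : NCPoly k n} (hp : p ∈ I) :
    rightDer χ j p ∈ I := by
  have h := hI.coideal p hp
  suffices h2 : LinearMap.range (TensorProduct.map (I.restrictScalars k).subtype
        (LinearMap.id : NCPoly k n →ₗ[k] NCPoly k n)) ⊔
      LinearMap.range (TensorProduct.map (LinearMap.id : NCPoly k n →ₗ[k] NCPoly k n)
        (I.restrictScalars k).subtype) ≤ (I.restrictScalars k).comap
        ((TensorProduct.rid k (NCPoly k n)).toLinearMap ∘ₗ
          TensorProduct.map LinearMap.id (coeff [j])) from h2 h
  refine sup_le ?_ ?_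
  · rintro _ ⟨z, rfl⟩
    induction z with
    | zero => simp
    | add x y hx hy => rw [map_add]; exact add_mem hx hy
    | tmul a b =>
      simpa using (I.restrictScalars k).smul_mem (coeff [j] b) a.2
  · rintro _ ⟨z, rfl⟩
    induction z with
    | zero => simp
    | add x y hx hy => rw [map_add]; exact add_mem hx hy
    | tmul a b =>
      have := hI.coeff_eq_zero (w := [j]) (by simp) b.2
      simp [this]

end Biideal

/-! ### Commutation of `E_i` with polynomials in the `F_j`. -/

section Commutator

variable {k : Type*} [Field k] {n : ℕ} (χ : Bicharacter k n) {R : Type*} [Ring R] [Algebra k R]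

theorem mul_lift_eq_lift_weightAct_mul {f : Fin n → R} {t : R} {l : Fin n → ℤ}
    (h : ∀ j, t * f j = chi χ l (sroot j) • (f j * t)) (p : NCPoly k n) :
    t * FreeAlgebra.lift k f p = FreeAlgebra.lift k f (weightAct χ l p) * t := by
  induction p using nc_induction k with
  | hm w =>
    induction w with
    | nil => simp [monomialOf_nil]
    | cons i w ih =>
      rw [monomialOf_cons, map_mul, map_mul, map_mul, weightAct_ι, map_smul,
        FreeAlgebra.lift_ι_apply, ← mul_assoc, h, smul_mul_assoc, mul_assoc, ih, smul_mul_assoc,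
        smul_mul_assoc, mul_assoc]
  | ha p q hp hq => simp only [map_add, mul_add, add_mul, hp, hq]
  | hs r p hp => simp only [map_smul, mul_smul_comm, smul_mul_assoc, hp]

/-- Carrying `e = E_i` through a word produces a term with `s = K_i` or `t = K_i⁻¹` for each letter
`x_i` passed. Collecting every `s` on the left and every `t` on the right produces the scalars of
the two skew derivations; symmetry of `q` reconciles the two conventions. The setting is an abstract
algebra because the identity is needed for operators before `U(χ)` is known to act. -/
theorem mul_lift_eq_lift_mul_add_derivations (hχ : ∀ i j, qmat χ i j = qmat χ j i) {i : Fin n}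
    {f : Fin n → R} {e s t : R}
    (he : ∀ j, e * f j = f j * e + if i = j then s - t else 0)
    (hs : ∀ j, f j * s = qmat χ i j • (s * f j))
    (ht : ∀ j, t * f j = qmat χ i j • (f j * t)) (p : NCPoly k n) :
    e * FreeAlgebra.lift k f p = FreeAlgebra.lift k f p * e +
      s * FreeAlgebra.lift k f (leftDer χ i p) - FreeAlgebra.lift k f (rightDer χ i p) * t := by
  induction p using nc_induction k with
  | hm w =>
    induction w with
    | nil => simp [monomialOf_nil, leftDer_one, rightDer_one]
    | cons j w ih =>
      have h1 := mul_lift_eq_lift_weightAct_mul χ (l := sroot i) ht (monomialOf k w)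
      rw [monomialOf_cons, map_mul, FreeAlgebra.lift_ι_apply, ← mul_assoc, he, add_mul, mul_assoc,
        ih, leftDer_mul, rightDer_mul, map_add, map_smul, map_mul, FreeAlgebra.lift_ι_apply,
        map_add, map_mul, FreeAlgebra.lift_ι_apply, hχ j i, mul_add, mul_smul_comm, ← mul_assoc s,
        ← smul_mul_assoc, ← hs, mul_sub, mul_add]
      by_cases h : i = j
      · subst h
        simp only [if_true, sub_mul, h1, add_mul, mul_assoc]
        abel
      · simp only [h, Ne.symm h, if_false, zero_mul, map_zero, add_zero, mul_zero, zero_add,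
          mul_assoc]
  | ha p q hp hq =>
    simp only [map_add, mul_add, add_mul, hp, hq]
    abel
  | hs r p hp =>
    simp only [map_smul, mul_smul_comm, smul_mul_assoc, hp, smul_add, smul_sub]

end Commutator

/-! ### The representation of `U(χ)` on the triangular tensor product. -/

section Representation

variable {k : Type*} [Field k] {n : ℕ} {χ : Bicharacter k n} {I : Ideal (NCPoly k n)}

/-- The vector space underlying the pre-Nichols algebra `T(V) / I`. -/
abbrev PreNichols (I : Ideal (NCPoly k n)) : Type _ := NCPoly k n ⧸ I.restrictScalars k

/-- The space `T(V) / I ⊗ k[ℤ^n] ⊗ T(V) / I`. -/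
abbrev Triangular (I : Ideal (NCPoly k n)) : Type _ :=
  PreNichols I ⊗[k] (((Fin n → ℤ) →₀ k) ⊗[k] PreNichols I)

/-- The tensor `p ⊗ K_l ⊗ q`. -/
def tri (I : Ideal (NCPoly k n)) (p : NCPoly k n) (l : Fin n → ℤ) (q : NCPoly k n) :
    Triangular I :=
  (I.restrictScalars k).mkQ p ⊗ₜ (Finsupp.single l 1 ⊗ₜ (I.restrictScalars k).mkQ q)

theorem tri_add_left (p p' : NCPoly k n) (l : Fin n → ℤ) (q : NCPoly k n) :
    tri I (p + p') l q = tri I p l q + tri I p' l q := by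
  simp only [tri, map_add, TensorProduct.add_tmul]

theorem tri_smul_left (r : k) (p : NCPoly k n) (l : Fin n → ℤ) (q : NCPoly k n) :
    tri I (r • p) l q = r • tri I p l q := by
  simp only [tri, map_smul, TensorProduct.smul_tmul']

theorem tri_smul_right (r : k) (p : NCPoly k n) (l : Fin n → ℤ) (q : NCPoly k n) :
    tri I p l (r • q) = r • tri I p l q := by
  simp only [tri, map_smul, TensorProduct.tmul_smul]

theorem tri_eq_zero_left {p : NCPoly k n} (hp : p ∈ I) (l : Fin n → ℤ) (q : NCPoly k n) :
    tri I p l q = 0 := by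
  have : (I.restrictScalars k).mkQ p = 0 := (Submodule.Quotient.mk_eq_zero _).2 hp
  rw [tri, this, TensorProduct.zero_tmul]

theorem tri_eq_zero_right (p : NCPoly k n) (l : Fin n → ℤ) {q : NCPoly k n} (hq : q ∈ I) :
    tri I p l q = 0 := by
  have : (I.restrictScalars k).mkQ q = 0 := (Submodule.Quotient.mk_eq_zero _).2 hq
  rw [tri, this, TensorProduct.tmul_zero, TensorProduct.tmul_zero]

theorem tri_zero_left (l : Fin n → ℤ) (q : NCPoly k n) : tri I 0 l q = 0 :=
  tri_eq_zero_left I.zero_mem l q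

theorem triangular_ext {N : Type*} [AddCommGroup N] [Module k N] {f g : Triangular I →ₗ[k] N}
    (h : ∀ p l q, f (tri I p l q) = g (tri I p l q)) : f = g := by
  refine TensorProduct.ext' fun x y => ?_
  obtain ⟨p, rfl⟩ := Submodule.mkQ_surjective _ x
  induction y with
  | zero => simp
  | add y z hy hz => rw [TensorProduct.tmul_add, map_add, map_add, hy, hz]
  | tmul s z =>
    obtain ⟨q, rfl⟩ := Submodule.mkQ_surjective _ z
    induction s using Finsupp.induction_linear with
    | zero => simp
    | add s t hs ht => rw [TensorProduct.add_tmul, TensorProduct.tmul_add, map_add, map_add, hs, ht]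
    | single l r =>
      have : Finsupp.single l r = r • Finsupp.single l (1 : k) := by simp
      rw [this, TensorProduct.smul_tmul, TensorProduct.tmul_smul, TensorProduct.tmul_smul, map_smul,
        map_smul]
      exact congrArg _ (h p l q)

/-- The linear endomorphism of `T(V) / I` induced by a linear endomorphism of `T(V)`. -/
def descend (I : Ideal (NCPoly k n)) (f : NCPoly k n →ₗ[k] NCPoly k n) (hf : ∀ p ∈ I, f p ∈ I) :
    PreNichols I →ₗ[k] PreNichols I :=
  Submodule.mapQ _ _ f hf

theorem descend_mkQ (f : NCPoly k n →ₗ[k] NCPoly k n) (hf : ∀ p ∈ I, f p ∈ I) (p : NCPoly k n) :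
    descend I f hf ((I.restrictScalars k).mkQ p) = (I.restrictScalars k).mkQ (f p) := rfl

/-- Multiplication by `K_m` on `k[ℤ^n]`. -/
def shift (m : Fin n → ℤ) : ((Fin n → ℤ) →₀ k) →ₗ[k] ((Fin n → ℤ) →₀ k) :=
  Finsupp.linearCombination k fun l => Finsupp.single (m + l) 1

/-- The endomorphism of `k[ℤ^n]` that multiplies `K_l` by a scalar. -/
def rescale (s : (Fin n → ℤ) → k) : ((Fin n → ℤ) →₀ k) →ₗ[k] ((Fin n → ℤ) →₀ k) :=
  Finsupp.linearCombination k fun l => s l • Finsupp.single l 1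

theorem shift_single (m l : Fin n → ℤ) :
    shift m (Finsupp.single l (1 : k)) = Finsupp.single (m + l) 1 := by
  simp [shift]

theorem rescale_single (s : (Fin n → ℤ) → k) (l : Fin n → ℤ) :
    rescale s (Finsupp.single l (1 : k)) = s l • Finsupp.single l 1 := by
  rw [rescale, Finsupp.linearCombination_single, one_smul]

/-- The action of `E_i` on `T(V) / I ⊗ k[ℤ^n] ⊗ T(V) / I`. -/
def opE (I : Ideal (NCPoly k n)) (i : Fin n) : Module.End k (Triangular I) :=
  TensorProduct.map (descend I (LinearMap.mulLeft k (FreeAlgebra.ι k i))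
    fun _ hp => I.mul_mem_left _ hp) LinearMap.id

/-- The action of `K_m` on `T(V) / I ⊗ k[ℤ^n] ⊗ T(V) / I`. -/
def opK (hI : IsGradedBiideal χ I) (m : Fin n → ℤ) : Module.End k (Triangular I) :=
  TensorProduct.map (descend I (weightAct χ m).toLinearMap fun _ hp => hI.weightAct_mem m hp)
    (TensorProduct.map (shift m) LinearMap.id)

/-- The action of `F_j` on `T(V) / I ⊗ k[ℤ^n] ⊗ T(V) / I`. -/
def opF (hI : IsGradedBiideal χ I) (j : Fin n) : Module.End k (Triangular I) :=
  TensorProduct.map LinearMap.id (TensorProduct.map (rescale fun l => chi χ l (sroot j))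
      (descend I (LinearMap.mulLeft k (FreeAlgebra.ι k j)) fun _ hp => I.mul_mem_left _ hp)) -
    TensorProduct.map (descend I (rightDer χ j) fun _ hp => hI.rightDer_mem j hp)
      (TensorProduct.map (shift (sroot j)) LinearMap.id) +
    TensorProduct.map (descend I ((weightAct χ (-sroot j)).toLinearMap ∘ₗ leftDer χ j)
      fun _ hp => hI.weightAct_mem _ (hI.leftDer_mem j hp))
      (TensorProduct.map (shift (-sroot j)) LinearMap.id)

theorem opE_tri (i : Fin n) (p : NCPoly k n) (l : Fin n → ℤ) (q : NCPoly k n) :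
    opE I i (tri I p l q) = tri I (FreeAlgebra.ι k i * p) l q := rfl

variable (hI : IsGradedBiideal χ I)

theorem opK_tri (m : Fin n → ℤ) (p : NCPoly k n) (l : Fin n → ℤ) (q : NCPoly k n) :
    opK hI m (tri I p l q) = tri I (weightAct χ m p) (m + l) q := by
  simp only [opK, tri, TensorProduct.map_tmul, shift_single]
  rfl

/-- The formula is forced by moving `F_j` to the right past `p(E)`: the result is `p F_j`, minus the
right derivative times `K_j`, plus `K_j⁻¹` times the left derivative. The scalar in the first term
comes from moving `F_j` past `K_l`. -/
theorem opF_tri (j : Fin n) (p : NCPoly k n) (l : Fin n → ℤ) (q : NCPoly k n) :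
    opF hI j (tri I p l q) = chi χ l (sroot j) • tri I p l (FreeAlgebra.ι k j * q) -
      tri I (rightDer χ j p) (sroot j + l) q +
      tri I (weightAct χ (-sroot j) (leftDer χ j p)) (-sroot j + l) q := by
  simp only [opF, tri, TensorProduct.map_tmul, shift_single, descend_mkQ, LinearMap.add_apply,
    LinearMap.sub_apply, rescale_single, ← TensorProduct.smul_tmul', TensorProduct.tmul_smul]
  rfl

theorem opK_zero : opK hI 0 = 1 := triangular_ext fun p l q => by
  rw [opK_tri, weightAct_zero, zero_add, Module.End.one_apply]

theorem opK_add (a b : Fin n → ℤ) : opK hI (a + b) = opK hI a * opK hI b :=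
  triangular_ext fun p l q => by
    rw [Module.End.mul_apply, opK_tri, opK_tri, opK_tri, weightAct_add, add_assoc]

theorem opK_opE (a : Fin n → ℤ) (j : Fin n) :
    opK hI a * opE I j = chi χ a (sroot j) • (opE I j * opK hI a) :=
  triangular_ext fun p l q => by
    rw [LinearMap.smul_apply, Module.End.mul_apply, Module.End.mul_apply, opE_tri, opK_tri, opK_tri,
      opE_tri, map_mul, weightAct_ι, smul_mul_assoc, tri_smul_left]

theorem opF_opK (a : Fin n → ℤ) (j : Fin n) :
    opF hI j * opK hI a = chi χ a (sroot j) • (opK hI a * opF hI j) :=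
  triangular_ext fun p l q => by
    rw [LinearMap.smul_apply, Module.End.mul_apply, Module.End.mul_apply, opK_tri, opF_tri, opF_tri,
      map_add, map_sub, map_smul, opK_tri, opK_tri, opK_tri, leftDer_weightAct, rightDer_weightAct,
      map_smul, tri_smul_left, tri_smul_left, chi_add_left, smul_add, smul_sub, smul_smul,
      ← weightAct_add, ← weightAct_add, add_comm a (-sroot j), add_left_comm a (sroot j),
      add_left_comm a (-sroot j)]

theorem opK_opF (a : Fin n → ℤ) (j : Fin n) :
    opK hI a * opF hI j = (chi χ a (sroot j))⁻¹ • (opF hI j * opK hI a) := by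
  rw [opF_opK, smul_smul, inv_mul_cancel₀ (chi_ne_zero _ _ _), one_smul]

/-- The two Leibniz rules make all terms cancel except those in which the new letter `x_i` is itself
removed; these are `K_i` and `-K_i⁻¹`. -/
theorem opE_opF (hχ : ∀ i j, qmat χ i j = qmat χ j i) (i j : Fin n) :
    opE I i * opF hI j =
      opF hI j * opE I i + if i = j then opK hI (sroot i) - opK hI (-sroot i) else 0 :=
  triangular_ext fun p l q => by
    -- By symmetry of `q`, the scalar from the action of `K_j⁻¹` on `x_i` is inverse to the one in
    -- the left Leibniz rule.
    have hq : chi χ (-sroot j) (sroot i) = (qmat χ i j)⁻¹ := by rw [chi_neg_left, hχ i j]; rfl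
    have h0 : qmat χ i j ≠ 0 := chi_ne_zero _ _ _
    rw [LinearMap.add_apply, Module.End.mul_apply, Module.End.mul_apply, opE_tri, opF_tri, opF_tri,
      map_add, map_sub, map_smul, opE_tri, opE_tri, opE_tri, rightDer_mul, leftDer_mul, map_add,
      map_smul, map_mul, weightAct_ι, hq, smul_mul_assoc, smul_smul, mul_inv_cancel₀ h0, one_smul,
      tri_add_left, tri_add_left]
    by_cases h : i = j
    · subst h
      simp only [if_true, LinearMap.sub_apply, opK_tri]
      abel
    · simp only [h, if_false, LinearMap.zero_apply, map_zero, tri_zero_left]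
      abel

theorem lift_opE_tri (p a : NCPoly k n) (l : Fin n → ℤ) (b : NCPoly k n) :
    FreeAlgebra.lift k (opE I) p (tri I a l b) = tri I (p * a) l b := by
  induction p using nc_induction k with
  | hm w =>
    induction w with
    | nil => simp [monomialOf_nil]
    | cons i w ih =>
      rw [monomialOf_cons, map_mul, FreeAlgebra.lift_ι_apply, Module.End.mul_apply, ih, opE_tri,
        mul_assoc]
  | ha p q hp hq => rw [map_add, LinearMap.add_apply, hp, hq, add_mul, tri_add_left]
  | hs r p hp => rw [map_smul, LinearMap.smul_apply, hp, smul_mul_assoc, tri_smul_left]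

theorem lift_opF_tri_one (p : NCPoly k n) (l : Fin n → ℤ) (b : NCPoly k n) :
    FreeAlgebra.lift k (opF hI) p (tri I 1 l b) = tri I 1 l (weightAct χ l p * b) := by
  induction p using nc_induction k with
  | hm w =>
    induction w with
    | nil => simp [monomialOf_nil]
    | cons i w ih =>
      rw [monomialOf_cons, map_mul, FreeAlgebra.lift_ι_apply, Module.End.mul_apply, ih, opF_tri,
        leftDer_one, rightDer_one, map_zero, tri_zero_left, tri_zero_left, sub_zero, add_zero,
        map_mul, weightAct_ι, smul_mul_assoc, smul_mul_assoc, tri_smul_right, mul_assoc]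
  | ha p q hp hq =>
    rw [map_add, LinearMap.add_apply, hp, hq, map_add, add_mul]
    simp only [tri, map_add, TensorProduct.tmul_add]
  | hs r p hp =>
    rw [map_smul, LinearMap.smul_apply, hp, map_smul, smul_mul_assoc, tri_smul_right]

theorem lift_opE_eq_zero [I.IsTwoSided]
    {p : NCPoly k n} (hp : p ∈ I) : FreeAlgebra.lift k (opE I) p = 0 :=
  triangular_ext fun a l b => by
    rw [lift_opE_tri, tri_eq_zero_left (I.mul_mem_right a hp), LinearMap.zero_apply]

/-- This is where the coideal property is needed: an element of `I` applied to `x_i w` is expressed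
through itself and its skew derivatives applied to `w`. -/
theorem lift_opF_eq_zero (hχ : ∀ i j, qmat χ i j = qmat χ j i) {p : NCPoly k n} (hp : p ∈ I) :
    FreeAlgebra.lift k (opF hI) p = 0 := by
  have hts := hI.twoSided
  -- The claim ranges over all of `I` at once, since the induction on `w` replaces `p` by its skew
  -- derivatives.
  have key : ∀ (w : List (Fin n)) (p : NCPoly k n), p ∈ I → ∀ (l : Fin n → ℤ) (b : NCPoly k n),
      FreeAlgebra.lift k (opF hI) p (tri I (monomialOf k w) l b) = 0 := by
    intro w
    induction w with
    | nil =>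
      intro p hp l b
      rw [monomialOf_nil, lift_opF_tri_one,
        tri_eq_zero_right _ _ (I.mul_mem_right b (hI.weightAct_mem l hp))]
    | cons i w ih =>
      intro p hp l b
      have h := mul_lift_eq_lift_mul_add_derivations χ hχ (i := i) (f := opF hI) (e := opE I i)
        (s := opK hI (sroot i)) (t := opK hI (-sroot i)) (opE_opF hI hχ i)
        (fun j => opF_opK hI _ j)
        (fun j => by rw [opK_opF, chi_neg_left, inv_inv]; rfl) p
      have h2 := LinearMap.congr_fun h (tri I (monomialOf k w) l b)
      simp only [LinearMap.sub_apply, LinearMap.add_apply, Module.End.mul_apply, opE_tri, opK_tri,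
        ih p hp, ih _ (hI.leftDer_mem i hp), weightAct_monomialOf, tri_smul_left, map_smul,
        ih _ (hI.rightDer_mem i hp), map_zero, smul_zero, add_zero, sub_zero] at h2
      rw [monomialOf_cons, ← h2]
  refine triangular_ext fun a l b => ?_
  induction a using nc_induction k with
  | hm w => exact key w p hp l b
  | ha a a' h h' => rw [tri_add_left, map_add, map_add, h, h']
  | hs r a h => rw [tri_smul_left, map_smul, map_smul, h]

/-- The action of the generators of `U(χ)` on `T(V) / I ⊗ k[ℤ^n] ⊗ T(V) / I`. -/
def opGen : DGen n → Module.End k (Triangular I)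
  | .E i => opE I i
  | .F i => opF hI i
  | .K l => opK hI l

theorem lift_comp_lift {R X Y : Type*} [Semiring R] [Algebra k R] (f : Y → R) (g : X → Y)
    (p : FreeAlgebra k X) :
    FreeAlgebra.lift k f (FreeAlgebra.lift k (fun i => FreeAlgebra.ι k (g i)) p) =
      FreeAlgebra.lift k (fun i => f (g i)) p := by
  have : (FreeAlgebra.lift k f).comp (FreeAlgebra.lift k (fun i => FreeAlgebra.ι k (g i))) =
      FreeAlgebra.lift k (fun i => f (g i)) := by
    ext i; simp
  exact DFunLike.congr_fun this p

/-- The representation of `U(χ)` on `T(V) / I ⊗ k[ℤ^n] ⊗ T(V) / I` by left multiplication in the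
triangular decomposition. -/
def rep (hχ : ∀ i j, qmat χ i j = qmat χ j i) : Double χ I →ₐ[k] Module.End k (Triangular I) :=
  RingQuot.liftAlgHom k ⟨FreeAlgebra.lift k (opGen hI), by
    intro x y h
    induction h with
    | K_zero => simpa [fgen, opGen] using opK_zero hI
    | K_add a b => simpa [fgen, opGen] using opK_add hI a b
    | K_E a j => simpa [fgen, opGen] using opK_opE hI a j
    | K_F a j => simpa [fgen, opGen] using opK_opF hI a j
    | E_F i j =>
      have h : opE I i * opF hI j - opF hI j * opE I i =
          if i = j then opK hI (sroot i) - opK hI (-sroot i) else 0 := by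
        rw [opE_opF hI hχ i j]
        exact LinearMap.ext fun x => add_sub_cancel_left _ _
      rw [map_sub, map_mul, map_mul]
      simp only [fgen, FreeAlgebra.lift_ι_apply]
      refine h.trans ?_
      split_ifs <;> simp [opGen]
    | ideal_E p hp =>
      refine (lift_comp_lift _ _ p).trans ?_
      rw [map_zero]
      have := hI.twoSided
      exact lift_opE_eq_zero hp
    | ideal_F p hp =>
      refine (lift_comp_lift _ _ p).trans ?_
      rw [map_zero]
      exact lift_opF_eq_zero hI hχ hp⟩

theorem rep_dgen (hχ : ∀ i j, qmat χ i j = qmat χ j i) (g : DGen n) :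
    rep hI hχ (dgen χ I g) = opGen hI g := by
  refine (RingQuot.liftAlgHom_mkAlgHom_apply k _ _ _).trans ?_
  exact FreeAlgebra.lift_ι_apply _ _

end Representation

/-! ### Direct sums recognised by their projections. -/

section LinearAlgebra

variable {k M ι : Type*} [Field k] [AddCommGroup M] [Module k M]

theorem projAlong_eq {V W : Submodule k M} (h : IsCompl V W) {p : M →ₗ[k] M}
    (hV : ∀ x ∈ V, p x = x) (hW : ∀ x ∈ W, p x = 0) : projAlong V W = p := by
  rw [projAlong, dif_pos h]
  refine LinearMap.ext fun x => ?_
  have hx : x ∈ V ⊔ W := h.sup_eq_top ▸ Submodule.mem_top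
  obtain ⟨v, hv, w, hw, rfl⟩ := Submodule.mem_sup.1 hx
  rw [map_add, map_add, hV v hv, hW w hw, Submodule.projection_apply_of_mem_left h hv,
    Submodule.projection_apply_of_mem_right h hw]

/-- A map that fixes one summand and kills the others forces independence, and it is then the
canonical projection. -/
theorem isInternal_of_projections [DecidableEq ι] {S : ι → Submodule k M} {p : ι → M →ₗ[k] M}
    (h1 : ∀ i, ∀ x ∈ S i, p i x = x) (h0 : ∀ i j, j ≠ i → ∀ x ∈ S j, p i x = 0)
    (htop : iSup S = ⊤) : DirectSum.IsInternal S ∧ ∀ i, componentProj S i = p i := by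
  have hker : ∀ i, (⨆ j, ⨆ (_ : j ≠ i), S j) ≤ LinearMap.ker (p i) := fun i =>
    iSup₂_le fun j hj x hx => h0 i j hj x hx
  have hdisj : iSupIndep S := fun i => by
    rw [Submodule.disjoint_def]
    intro x hx hx2
    rw [← h1 i x hx]
    exact hker i hx2
  refine ⟨DirectSum.isInternal_submodule_of_iSupIndep_of_iSup_eq_top hdisj htop, fun i => ?_⟩
  refine projAlong_eq ⟨hdisj i, ?_⟩ (h1 i) fun x hx => hker i hx
  rw [codisjoint_iff, ← htop]
  refine le_antisymm (sup_le (le_iSup S i) (iSup₂_le fun j _ => le_iSup S j)) (iSup_le fun j => ?_)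
  by_cases h : j = i
  · subst h; exact le_sup_left
  · exact le_sup_of_le_right (le_iSup₂_of_le (f := fun j (_ : j ≠ i) => S j) j h le_rfl)

open Classical in
-- The projection onto the sum of the components indexed by `S`, obtained through the isomorphism
-- with the external direct sum because `S` may be infinite.
theorem exists_selector [DecidableEq ι] {T : ι → Submodule k M} (h : DirectSum.IsInternal T)
    (S : Set ι) : ∃ p : M →ₗ[k] M, ∀ j, ∀ x ∈ T j, p x = if j ∈ S then x else 0 := by
  let e := LinearEquiv.ofBijective (DirectSum.coeLinearMap T) h
  refine ⟨(DirectSum.toModule k ι M fun j => if j ∈ S then (T j).subtype else 0) ∘ₗ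
    e.symm.toLinearMap, fun j x hx => ?_⟩
  have he : e.symm x = DirectSum.lof k ι (fun j => T j) j ⟨x, hx⟩ := by
    rw [LinearEquiv.symm_apply_eq]
    exact (DirectSum.coeLinearMap_lof T j ⟨x, hx⟩).symm
  rw [LinearMap.comp_apply, LinearEquiv.coe_coe, he, DirectSum.toModule_lof]
  split_ifs <;> rfl

end LinearAlgebra

/-! ### Normally ordered monomials span `U(χ)`. -/

section NormalForm

variable {k : Type*} [Field k] {n : ℕ} (χ : Bicharacter k n) (I : Ideal (NCPoly k n))

theorem K_mul_E (a : Fin n → ℤ) (j : Fin n) :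
    K χ I a * E χ I j = chi χ a (sroot j) • (E χ I j * K χ I a) := by
  have h := RingQuot.mkAlgHom_rel k (DRel.K_E (χ := χ) (I := I) a j)
  rw [map_smul, map_mul, map_mul] at h
  exact h

theorem K_mul_F (a : Fin n → ℤ) (j : Fin n) :
    K χ I a * F χ I j = (chi χ a (sroot j))⁻¹ • (F χ I j * K χ I a) := by
  have h := RingQuot.mkAlgHom_rel k (DRel.K_F (χ := χ) (I := I) a j)
  rw [map_smul, map_mul, map_mul] at h
  exact h

theorem F_mul_K (a : Fin n → ℤ) (j : Fin n) :
    F χ I j * K χ I a = chi χ a (sroot j) • (K χ I a * F χ I j) := by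
  rw [K_mul_F, smul_smul, mul_inv_cancel₀ (chi_ne_zero _ _ _), one_smul]

theorem F_mul_E (i j : Fin n) :
    F χ I j * E χ I i =
      E χ I i * F χ I j - if i = j then K χ I (sroot i) - K χ I (-sroot i) else 0 := by
  have h := RingQuot.mkAlgHom_rel k (DRel.E_F (χ := χ) (I := I) i j)
  rw [map_sub, map_mul, map_mul] at h
  have h2 : E χ I i * F χ I j - F χ I j * E χ I i =
      if i = j then K χ I (sroot i) - K χ I (-sroot i) else 0 := by
    refine h.trans ?_
    split_ifs
    · exact map_sub _ _ _
    · exact map_zero _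
  rw [← h2, sub_sub_cancel]

theorem lift_E_eq_zero {p : NCPoly k n} (hp : p ∈ I) : FreeAlgebra.lift k (E χ I) p = 0 := by
  have h := RingQuot.mkAlgHom_rel k (DRel.ideal_E (χ := χ) (I := I) p hp)
  rw [map_zero] at h
  refine Eq.trans ?_ h
  have h2 : FreeAlgebra.lift k (E χ I) = (RingQuot.mkAlgHom k (DRel χ I)).comp
      (FreeAlgebra.lift k fun i => fgen k (.E i)) := by
    ext i
    rw [Function.comp_apply, FreeAlgebra.lift_ι_apply]
    exact congrArg (RingQuot.mkAlgHom k (DRel χ I))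
      (FreeAlgebra.lift_ι_apply (fun i => fgen k (.E i)) i).symm
  exact DFunLike.congr_fun h2 p

theorem lift_F_eq_zero {p : NCPoly k n} (hp : p ∈ I) : FreeAlgebra.lift k (F χ I) p = 0 := by
  have h := RingQuot.mkAlgHom_rel k (DRel.ideal_F (χ := χ) (I := I) p hp)
  rw [map_zero] at h
  refine Eq.trans ?_ h
  have h2 : FreeAlgebra.lift k (F χ I) = (RingQuot.mkAlgHom k (DRel χ I)).comp
      (FreeAlgebra.lift k fun i => fgen k (.F i)) := by
    ext i
    rw [Function.comp_apply, FreeAlgebra.lift_ι_apply]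
    exact congrArg (RingQuot.mkAlgHom k (DRel χ I))
      (FreeAlgebra.lift_ι_apply (fun i => fgen k (.F i)) i).symm
  exact DFunLike.congr_fun h2 p

theorem double_induction {P : Double χ I → Prop} (hg : ∀ g, P (dgen χ I g))
    (hk : ∀ r : k, P (algebraMap k _ r)) (ha : ∀ x y, P x → P y → P (x + y))
    (hm : ∀ x y, P x → P y → P (x * y)) (x : Double χ I) : P x := by
  obtain ⟨y, rfl⟩ := RingQuot.mkAlgHom_surjective k (DRel χ I) x
  induction y using FreeAlgebra.induction with
  | grade0 r =>
    rw [AlgHom.commutes]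
    exact hk r
  | grade1 g => exact hg g
  | mul x y hx hy => rw [map_mul]; exact hm _ _ hx hy
  | add x y hx hy => rw [map_add]; exact ha _ _ hx hy

/-- A word in the `E_i`. -/
def wordE (w : List (Fin n)) : Double χ I := (w.map (E χ I)).prod

/-- A word in the `F_i`. -/
def wordF (w : List (Fin n)) : Double χ I := (w.map (F χ I)).prod

/-- A normally ordered monomial `E_w K_l F_v`. -/
def nf (w : List (Fin n)) (l : Fin n → ℤ) (v : List (Fin n)) : Double χ I :=
  wordE χ I w * K χ I l * wordF χ I v

variable {χ I}

theorem wordE_nil : wordE χ I [] = 1 := rfl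

theorem wordF_nil : wordF χ I [] = 1 := rfl

theorem wordE_cons (i : Fin n) (w : List (Fin n)) :
    wordE χ I (i :: w) = E χ I i * wordE χ I w := by simp [wordE]

theorem wordF_cons (i : Fin n) (w : List (Fin n)) :
    wordF χ I (i :: w) = F χ I i * wordF χ I w := by simp [wordF]

theorem wordF_append (v w : List (Fin n)) :
    wordF χ I (v ++ w) = wordF χ I v * wordF χ I w := by simp [wordF]

theorem nf_nil_nil (l : Fin n → ℤ) : nf χ I [] l [] = K χ I l := by
  simp [nf, wordE_nil, wordF_nil]

theorem K_mul_wordE (a : Fin n → ℤ) (w : List (Fin n)) :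
    K χ I a * wordE χ I w = chi χ a (wt w) • (wordE χ I w * K χ I a) := by
  have h := mul_lift_eq_lift_weightAct_mul χ (K_mul_E χ I a) (monomialOf k w)
  rw [weightAct_monomialOf, map_smul, lift_monomialOf, smul_mul_assoc] at h
  exact h

theorem E_mul_nf (i : Fin n) (w : List (Fin n)) (l : Fin n → ℤ) (v : List (Fin n)) :
    E χ I i * nf χ I w l v = nf χ I (i :: w) l v := by
  simp only [nf, wordE_cons, mul_assoc]

theorem K_mul_nf (a : Fin n → ℤ) (w : List (Fin n)) (l : Fin n → ℤ) (v : List (Fin n)) :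
    K χ I a * nf χ I w l v = chi χ a (wt w) • nf χ I w (a + l) v := by
  rw [nf, ← mul_assoc, ← mul_assoc, K_mul_wordE, nf, K_add, smul_mul_assoc, smul_mul_assoc]
  simp only [mul_assoc]

theorem nf_mul_wordF (w : List (Fin n)) (l : Fin n → ℤ) (v v' : List (Fin n)) :
    nf χ I w l v * wordF χ I v' = nf χ I w l (v ++ v') := by
  simp only [nf, wordF_append, mul_assoc]

/-- The multidegrees of normally ordered monomials. -/
abbrev Tri (n : ℕ) : Type := (Fin n → ℕ) × (Fin n → ℤ) × (Fin n → ℕ)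

variable (χ I)

/-- The span of the normally ordered monomials whose multidegree lies in a given set. -/
def nfSpan (S : Set (Tri n)) : Submodule k (Double χ I) :=
  Submodule.span k {x | ∃ w l v, (content w, l, content v) ∈ S ∧ nf χ I w l v = x}

variable {χ I}

theorem nf_mem {S : Set (Tri n)} {w : List (Fin n)} {l : Fin n → ℤ} {v : List (Fin n)}
    (h : (content w, l, content v) ∈ S) : nf χ I w l v ∈ nfSpan χ I S :=
  Submodule.subset_span ⟨w, l, v, h, rfl⟩

theorem nfSpan_le {S : Set (Tri n)} {X : Submodule k (Double χ I)}
    (h : ∀ w l v, (content w, l, content v) ∈ S → nf χ I w l v ∈ X) : nfSpan χ I S ≤ X := by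
  refine Submodule.span_le.2 ?_
  rintro _ ⟨w, l, v, hS, rfl⟩
  exact h w l v hS

theorem nfSpan_mono {S T : Set (Tri n)} (h : S ⊆ T) : nfSpan χ I S ≤ nfSpan χ I T :=
  nfSpan_le fun _ _ _ hS => nf_mem (h hS)

theorem mul_mem_nfSpan {S T : Set (Tri n)} {a : Double χ I}
    (h : ∀ w l v, (content w, l, content v) ∈ S → a * nf χ I w l v ∈ nfSpan χ I T)
    {x : Double χ I} (hx : x ∈ nfSpan χ I S) : a * x ∈ nfSpan χ I T :=
  nfSpan_le (X := (nfSpan χ I T).comap (LinearMap.mulLeft k a)) h hx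

/-- The multidegrees that occur in the product of `F_j` and a normally ordered monomial. -/
def fStep (j : Fin n) (t : Tri n) : Set (Tri n) :=
  {x | x = (t.1, t.2.1, t.2.2 + Pi.single j 1) ∨ ∃ a, t.1 = a + Pi.single j 1 ∧
    (x = (a, sroot j + t.2.1, t.2.2) ∨ x = (a, -sroot j + t.2.1, t.2.2))}

/-- Each commutator of `F_j` with a letter `E_j` deletes that letter and leaves `K_j` or `K_j⁻¹`,
which is then moved to the right end. Recording only the multidegree of what remains suffices for
every later estimate. -/
theorem F_mul_wordE (j : Fin n) (w : List (Fin n)) :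
    F χ I j * wordE χ I w - wordE χ I w * F χ I j ∈ Submodule.span k
      {x | ∃ w', content w = content w' + Pi.single j 1 ∧
        (wordE χ I w' * K χ I (sroot j) = x ∨ wordE χ I w' * K χ I (-sroot j) = x)} := by
  induction w with
  | nil => simp [wordE_nil]
  | cons i w ih =>
    have e : F χ I j * wordE χ I (i :: w) - wordE χ I (i :: w) * F χ I j =
        E χ I i * (F χ I j * wordE χ I w - wordE χ I w * F χ I j) -
          (if i = j then K χ I (sroot i) - K χ I (-sroot i) else 0) * wordE χ I w := by
      rw [wordE_cons, ← mul_assoc, F_mul_E]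
      simp only [sub_mul, mul_sub, mul_assoc]
      abel
    rw [e]
    refine sub_mem ?_ ?_
    · refine Submodule.mem_comap.1 ((Submodule.span_le
        (p := Submodule.comap (LinearMap.mulLeft k (E χ I i)) _)).2 ?_ ih)
      rintro x ⟨w', hw', hx⟩
      refine Submodule.subset_span ⟨i :: w', ?_, ?_⟩
      · rw [content_cons, content_cons, hw', add_right_comm]
      · rw [wordE_cons, mul_assoc, mul_assoc]
        exact hx.imp (fun h => by rw [h]; rfl) (fun h => by rw [h]; rfl)
    · split_ifs with h
      · subst h
        rw [sub_mul, K_mul_wordE, K_mul_wordE]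
        exact sub_mem
          (Submodule.smul_mem _ _ (Submodule.subset_span ⟨w, content_cons i w, .inl rfl⟩))
          (Submodule.smul_mem _ _ (Submodule.subset_span ⟨w, content_cons i w, .inr rfl⟩))
      · rw [zero_mul]; exact zero_mem _

theorem F_mul_nf (j : Fin n) (w : List (Fin n)) (l : Fin n → ℤ) (v : List (Fin n)) :
    F χ I j * nf χ I w l v ∈ nfSpan χ I (fStep j (content w, l, content v)) := by
  have e : F χ I j * nf χ I w l v =
      (F χ I j * wordE χ I w - wordE χ I w * F χ I j) * (K χ I l * wordF χ I v) +
        chi χ l (sroot j) • nf χ I w l (j :: v) := by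
    rw [nf, nf, wordF_cons, sub_mul, mul_assoc (wordE χ I w) (F χ I j),
      ← mul_assoc (F χ I j) (K χ I l),
      F_mul_K, smul_mul_assoc, mul_smul_comm]
    simp only [mul_assoc]
    abel
  rw [e]
  refine add_mem ?_ (Submodule.smul_mem _ _ (nf_mem (.inl ?_)))
  · refine Submodule.mem_comap.1 ((Submodule.span_le (p := Submodule.comap
      (LinearMap.mulRight k (K χ I l * wordF χ I v)) _)).2 ?_ (F_mul_wordE j w))
    rintro x ⟨w', hw', hx⟩
    have key : ∀ m, wordE χ I w' * K χ I m * (K χ I l * wordF χ I v) = nf χ I w' (m + l) v := by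
      intro m
      simp only [nf, K_add, mul_assoc]
    rcases hx with rfl | rfl
    · rw [SetLike.mem_coe, Submodule.mem_comap, LinearMap.mulRight_apply, key]
      exact nf_mem (.inr ⟨_, hw', .inl rfl⟩)
    · rw [SetLike.mem_coe, Submodule.mem_comap, LinearMap.mulRight_apply, key]
      exact nf_mem (.inr ⟨_, hw', .inr rfl⟩)
  · rw [content_cons]

theorem one_mem_nfSpan {S : Set (Tri n)} (h : (0, 0, 0) ∈ S) : (1 : Double χ I) ∈ nfSpan χ I S := by
  rw [← K_zero χ I, ← nf_nil_nil]
  exact nf_mem (by rwa [content_nil])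

/-- The span contains `1` and is stable under left multiplication by each generator, hence by all of
`U(χ)`. -/
theorem nfSpan_univ : nfSpan χ I Set.univ = ⊤ := by
  have key : ∀ x : Double χ I, ∀ y ∈ nfSpan χ I Set.univ, x * y ∈ nfSpan χ I Set.univ := by
    intro x
    induction x using double_induction χ I with
    | hg g =>
      intro y hy
      refine mul_mem_nfSpan (fun w l v _ => ?_) hy
      cases g with
      | E i =>
        change E χ I i * _ ∈ _
        rw [E_mul_nf]
        exact nf_mem trivial
      | F i => exact nfSpan_mono (Set.subset_univ _) (F_mul_nf i w l v)
      | K a =>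
        change K χ I a * _ ∈ _
        rw [K_mul_nf]
        exact Submodule.smul_mem _ _ (nf_mem trivial)
    | hk r =>
      intro y hy
      rw [← Algebra.smul_def]
      exact Submodule.smul_mem _ _ hy
    | ha a b ha hb =>
      intro y hy
      rw [add_mul]
      exact add_mem (ha y hy) (hb y hy)
    | hm a b ha hb =>
      intro y hy
      rw [mul_assoc]
      exact ha _ (hb y hy)
  refine eq_top_iff.2 fun x _ => ?_
  rw [← mul_one x]
  exact key x 1 (one_mem_nfSpan trivial)

theorem double_ext {N : Type*} [AddCommGroup N] [Module k N] {f g : Double χ I →ₗ[k] N}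
    (h : ∀ w l v, f (nf χ I w l v) = g (nf χ I w l v)) : f = g := by
  have h2 : (⊤ : Submodule k (Double χ I)) ≤ LinearMap.eqLocus f g := by
    rw [← nfSpan_univ]
    exact nfSpan_le fun w l v _ => h w l v
  exact LinearMap.ext fun x => h2 trivial

end NormalForm

/-! ### The triangular decomposition and the projections of (1). -/

section Triangular

variable {k : Type*} [Field k] {n : ℕ} {χ : Bicharacter k n} {I : Ideal (NCPoly k n)}
  (hI : IsGradedBiideal χ I) (hχ : ∀ i j, qmat χ i j = qmat χ j i)

/-- The map `U(χ) → T(V) / I ⊗ k[ℤ^n] ⊗ T(V) / I`, the action on `1 ⊗ 1 ⊗ 1`. -/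
def toTriangular : Double χ I →ₗ[k] Triangular I :=
  LinearMap.applyₗ (tri I 1 0 1) ∘ₗ (rep hI hχ).toLinearMap

/-- The factors act from right to left without correction terms: the `F_j` meet only `1` in the left
tensor factor, where both skew derivatives vanish, and `K_l` also fixes that `1`. -/
theorem toTriangular_nf (w : List (Fin n)) (l : Fin n → ℤ) (v : List (Fin n)) :
    toTriangular hI hχ (nf χ I w l v) = tri I (monomialOf k w) l (monomialOf k v) := by
  have hE : rep hI hχ (wordE χ I w) = FreeAlgebra.lift k (opE I) (monomialOf k w) := by
    rw [lift_monomialOf, wordE, map_list_prod, List.map_map]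
    exact congrArg List.prod (List.map_congr_left fun i _ => rep_dgen hI hχ (.E i))
  have hF : rep hI hχ (wordF χ I v) = FreeAlgebra.lift k (opF hI) (monomialOf k v) := by
    rw [lift_monomialOf, wordF, map_list_prod, List.map_map]
    exact congrArg List.prod (List.map_congr_left fun i _ => rep_dgen hI hχ (.F i))
  have hK : rep hI hχ (K χ I l) = opK hI l := rep_dgen hI hχ (.K l)
  change rep hI hχ (nf χ I w l v) (tri I 1 0 1) = _
  rw [nf, map_mul, map_mul, hE, hF, hK, Module.End.mul_apply, Module.End.mul_apply,
    lift_opF_tri_one, opK_tri, lift_opE_tri, map_one, weightAct_zero, mul_one, mul_one, add_zero]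

variable (χ I) in
/-- The multiplication map `T(V) / I ⊗ k[ℤ^n] ⊗ T(V) / I → U(χ)`. -/
def ofTriangular : Triangular I →ₗ[k] Double χ I :=
  LinearMap.mul' k _ ∘ₗ TensorProduct.map
    (Submodule.liftQ _ (FreeAlgebra.lift k (E χ I)).toLinearMap fun _ hp => lift_E_eq_zero χ I hp)
    (LinearMap.mul' k _ ∘ₗ TensorProduct.map (Finsupp.linearCombination k (K χ I))
      (Submodule.liftQ _ (FreeAlgebra.lift k (F χ I)).toLinearMap
        fun _ hp => lift_F_eq_zero χ I hp))

theorem ofTriangular_tri (w : List (Fin n)) (l : Fin n → ℤ) (v : List (Fin n)) :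
    ofTriangular χ I (tri I (monomialOf k w) l (monomialOf k v)) = nf χ I w l v := by
  have h : ofTriangular χ I (tri I (monomialOf k w) l (monomialOf k v)) =
      FreeAlgebra.lift k (E χ I) (monomialOf k w) *
        (Finsupp.linearCombination k (K χ I) (Finsupp.single l 1) *
          FreeAlgebra.lift k (F χ I) (monomialOf k v)) := rfl
  rw [h, lift_monomialOf, lift_monomialOf, Finsupp.linearCombination_single, one_smul, nf,
      mul_assoc]
  rfl

/-- The projection of `U(χ)` to the span of the normally ordered monomials of a given
multidegree. -/
def triProj (t : Tri n) : Double χ I →ₗ[k] Double χ I :=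
  ofTriangular χ I ∘ₗ TensorProduct.map
    (descend I (homProj t.1) fun _ hp => hI.homProj_mem t.1 hp)
    (TensorProduct.map (rescale fun l => if l = t.2.1 then 1 else 0)
      (descend I (homProj t.2.2) fun _ hp => hI.homProj_mem t.2.2 hp)) ∘ₗ toTriangular hI hχ

theorem triProj_nf (t : Tri n) (w : List (Fin n)) (l : Fin n → ℤ) (v : List (Fin n)) :
    triProj hI hχ t (nf χ I w l v) = if (content w, l, content v) = t then nf χ I w l v else 0 := by
  obtain ⟨a, m, b⟩ := t
  have h : triProj hI hχ (a, m, b) (nf χ I w l v) = ofTriangular χ I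
      ((I.restrictScalars k).mkQ (homProj a (monomialOf k w)) ⊗ₜ
        (rescale (fun l => if l = m then 1 else 0) (Finsupp.single l 1) ⊗ₜ
          (I.restrictScalars k).mkQ (homProj b (monomialOf k v)))) := by
    rw [triProj, LinearMap.comp_apply, LinearMap.comp_apply, toTriangular_nf]
    rfl
  rw [h, homProj_monomialOf, homProj_monomialOf, rescale_single]
  by_cases h1 : content w = a
  · by_cases h2 : l = m
    · by_cases h3 : content v = b
      · rw [if_pos h1, if_pos h2, if_pos h3, if_pos (by rw [h1, h2, h3]), one_smul]
        exact ofTriangular_tri w l v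
      · simp [h3]
    · simp [h2]
  · simp [h1]

/-- Projecting the tensor product to one multidegree is well defined because `I` is graded.
Transported to `U(χ)`, this gives the maps that detect independence. -/
theorem isInternal_nfSpan_singleton (hI : IsGradedBiideal χ I)
    (hχ : ∀ i j, qmat χ i j = qmat χ j i) :
    DirectSum.IsInternal fun t : Tri n => nfSpan χ I {t} := by
  refine (isInternal_of_projections (p := triProj hI hχ) ?_ ?_ ?_).1
  · intro t x hx
    refine nfSpan_le (X := LinearMap.eqLocus (triProj hI hχ t) LinearMap.id) ?_ hx
    intro w l v h
    exact (triProj_nf hI hχ t w l v).trans (if_pos h)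
  · intro t s hts x hx
    refine nfSpan_le (X := LinearMap.ker (triProj hI hχ t)) ?_ hx
    intro w l v h
    refine (triProj_nf hI hχ t w l v).trans (if_neg ?_)
    rintro rfl
    exact hts h.symm
  · rw [← top_le_iff, ← nfSpan_univ]
    exact nfSpan_le fun w l v _ => Submodule.mem_iSup_of_mem (content w, l, content v) (nf_mem rfl)

/-- Every coarsening of the multidegree grading is again a direct sum decomposition, with diagonal
projections on normally ordered monomials. Both decompositions in (1) arise in this way. -/
theorem isInternal_nfSpan (hI : IsGradedBiideal χ I) (hχ : ∀ i j, qmat χ i j = qmat χ j i)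
    {ι : Type*} [DecidableEq ι] (f : Tri n → ι) :
    (DirectSum.IsInternal fun i => nfSpan χ I (f ⁻¹' {i})) ∧
    ∀ i w l v, componentProj (fun i => nfSpan χ I (f ⁻¹' {i})) i (nf χ I w l v) =
      if f (content w, l, content v) = i then nf χ I w l v else 0 := by
  classical
  choose p hp using fun i => exists_selector (isInternal_nfSpan_singleton hI hχ) (f ⁻¹' {i})
  have hp2 : ∀ i w l v, p i (nf χ I w l v) =
      if f (content w, l, content v) = i then nf χ I w l v else 0 := fun i w l v => by
    rw [hp i (content w, l, content v) _ (nf_mem rfl)]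
    simp only [Set.mem_preimage, Set.mem_singleton_iff]
  have h := isInternal_of_projections (S := fun i => nfSpan χ I (f ⁻¹' {i})) (p := p) ?_ ?_ ?_
  · exact ⟨h.1, fun i w l v => by rw [h.2 i, hp2]⟩
  · intro i x hx
    refine nfSpan_le (X := LinearMap.eqLocus (p i) LinearMap.id) ?_ hx
    intro w l v h
    exact (hp2 i w l v).trans (if_pos h)
  · intro i j hij x hx
    refine nfSpan_le (X := LinearMap.ker (p i)) ?_ hx
    intro w l v h
    refine (hp2 i w l v).trans (if_neg ?_)
    rintro rfl
    exact hij h.symm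
  · rw [← top_le_iff, ← nfSpan_univ]
    exact nfSpan_le fun w l v _ =>
      Submodule.mem_iSup_of_mem (f (content w, l, content v)) (nf_mem rfl)

variable (χ I) in
theorem sumPi_eq (ab : (Fin n → ℕ) × (Fin n → ℕ)) :
    sumPi χ I ab = nfSpan χ I ((fun t : Tri n => (t.1, t.2.2)) ⁻¹' {ab}) := by
  obtain ⟨a, b⟩ := ab
  rw [sumPi, UplusDeg, UminusDeg, cartan, homogeneous, homogeneous, Submodule.map_span,
    Submodule.map_span, Submodule.span_mul_span, Submodule.span_mul_span, nfSpan]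
  congr 1
  ext x
  constructor
  · rintro ⟨_, ⟨_, ⟨_, ⟨w, hw, rfl⟩, rfl⟩, _, ⟨l, rfl⟩, rfl⟩, _, ⟨_, ⟨v, hv, rfl⟩, rfl⟩, rfl⟩
    refine ⟨w, l, v, Prod.ext (funext hw) (funext hv), ?_⟩
    simp only [AlgHom.toLinearMap_apply, lift_monomialOf]
    rfl
  · rintro ⟨w, l, v, h, rfl⟩
    have h1 : content w = a := congrArg Prod.fst h
    have h2 : content v = b := congrArg Prod.snd h
    refine ⟨_, ⟨_, ⟨_, ⟨w, congrFun h1, rfl⟩, rfl⟩, _, ⟨l, rfl⟩, rfl⟩, _,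
      ⟨_, ⟨v, congrFun h2, rfl⟩, rfl⟩, ?_⟩
    simp only [AlgHom.toLinearMap_apply, lift_monomialOf]
    rfl

theorem adjoin_range_eq_span {R : Type*} [Ring R] [Algebra k R] (f : Fin n → R) :
    Subalgebra.toSubmodule (Algebra.adjoin k (Set.range f)) =
      Submodule.span k (Set.range fun w : List (Fin n) => (w.map f).prod) := by
  apply le_antisymm
  · rw [Algebra.adjoin_range_eq_range_freeAlgebra_lift]
    rintro _ ⟨p, rfl⟩
    change FreeAlgebra.lift k f p ∈ _
    induction p using nc_induction k with
    | hm w =>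
      rw [lift_monomialOf]
      exact Submodule.subset_span ⟨w, rfl⟩
    | ha p q hp hq => rw [map_add]; exact add_mem hp hq
    | hs r p hp => rw [map_smul]; exact Submodule.smul_mem _ _ hp
  · refine Submodule.span_le.2 ?_
    rintro _ ⟨w, rfl⟩
    refine list_prod_mem (S := Algebra.adjoin k (Set.range f)) fun x hx => ?_
    obtain ⟨i, -, rfl⟩ := List.mem_map.1 hx
    exact Algebra.subset_adjoin ⟨i, rfl⟩

variable (χ I) in
theorem exists_wordF_mul_K (v : List (Fin n)) : ∃ s : k, s ≠ 0 ∧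
    (v.map fun i => F χ I i * K χ I (sroot i)).prod = s • (K χ I (wt v) * wordF χ I v) := by
  induction v with
  | nil => exact ⟨1, one_ne_zero, by simp [wt_nil, K_zero, wordF_nil]⟩
  | cons i v ih =>
    obtain ⟨s, hs, h⟩ := ih
    refine ⟨s * chi χ (sroot i + wt v) (sroot i), mul_ne_zero hs (chi_ne_zero _ _ _), ?_⟩
    rw [List.map_cons, List.prod_cons, h, wt_cons, wordF_cons, mul_smul_comm, ← mul_assoc,
      mul_assoc (F χ I i), ← K_add, F_mul_K, smul_mul_assoc, smul_smul, mul_assoc]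

variable (χ I) in
-- A word in the `F_i K_i` is a nonzero multiple of `K_{wt v} F_v`, so `U⁺ K_l G⁻` collects the
-- monomials `E_w K_m F_v` with `m = l + wt v`.
theorem sumP_eq (l : Fin n → ℤ) :
    sumP χ I l = nfSpan χ I ((fun t : Tri n => t.2.1 - toInt t.2.2) ⁻¹' {l}) := by
  rw [sumP, Uplus, Gminus, adjoin_range_eq_span, adjoin_range_eq_span, Submodule.span_mul_span,
    Submodule.span_mul_span]
  apply le_antisymm
  · refine Submodule.span_le.2 ?_
    rintro _ ⟨_, ⟨_, ⟨w, rfl⟩, _, rfl, rfl⟩, _, ⟨v, rfl⟩, rfl⟩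
    obtain ⟨s, -, h⟩ := exists_wordF_mul_K χ I v
    have e : wordE χ I w * K χ I l * (v.map fun i => F χ I i * K χ I (sroot i)).prod =
        s • nf χ I w (l + wt v) v := by
      rw [h, nf, K_add, mul_smul_comm]
      simp only [mul_assoc]
    change wordE χ I w * K χ I l * (v.map fun i => F χ I i * K χ I (sroot i)).prod ∈ _
    rw [e]
    refine Submodule.smul_mem _ _ (nf_mem ?_)
    exact add_sub_cancel_right l (wt v)
  · refine nfSpan_le fun w m v hm => ?_
    obtain ⟨s, hs, h⟩ := exists_wordF_mul_K χ I v
    have hm' : m = l + wt v := sub_eq_iff_eq_add.1 hm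
    have e : nf χ I w m v =
        s⁻¹ • (wordE χ I w * K χ I l * (v.map fun i => F χ I i * K χ I (sroot i)).prod) := by
      rw [h, nf, hm', K_add, mul_smul_comm, smul_smul, inv_mul_cancel₀ hs, one_smul]
      simp only [mul_assoc]
    rw [e]
    exact Submodule.smul_mem _ _ (Submodule.subset_span
      ⟨_, ⟨_, ⟨w, rfl⟩, _, rfl, rfl⟩, _, ⟨v, rfl⟩, rfl⟩)

theorem projPi_nf (hI : IsGradedBiideal χ I) (hχ : ∀ i j, qmat χ i j = qmat χ j i)
    (w : List (Fin n)) (l : Fin n → ℤ) (v : List (Fin n)) :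
    projPi χ I 0 0 (nf χ I w l v) = if w = [] ∧ v = [] then nf χ I w l v else 0 := by
  rw [projPi, funext (sumPi_eq χ I)]
  refine ((isInternal_nfSpan hI hχ _).2 _ w l v).trans ?_
  simp only [Prod.mk.injEq, content_eq_zero]

theorem projP_nf (hI : IsGradedBiideal χ I) (hχ : ∀ i j, qmat χ i j = qmat χ j i)
    (m : Fin n → ℤ) (w : List (Fin n)) (l : Fin n → ℤ) (v : List (Fin n)) :
    projP χ I m (nf χ I w l v) = if l - wt v = m then nf χ I w l v else 0 := by
  rw [projP, funext (sumP_eq χ I)]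
  exact (isInternal_nfSpan hI hχ _).2 _ w l v

/-- The coefficients of the elements `K_l` in an element of `U(χ)`, with respect to the triangular
decomposition. -/
def torusCoeff : Double χ I →ₗ[k] ((Fin n → ℤ) →₀ k) :=
  (TensorProduct.lid k _).toLinearMap ∘ₗ TensorProduct.map
      (Submodule.liftQ _ (coeff []) fun _ hp => hI.coeff_eq_zero (w := []) (by simp) hp)
      ((TensorProduct.rid k _).toLinearMap ∘ₗ TensorProduct.map LinearMap.id
        (Submodule.liftQ _ (coeff []) fun _ hp => hI.coeff_eq_zero (w := []) (by simp) hp)) ∘ₗ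
    toTriangular hI hχ

theorem torusCoeff_nf (w : List (Fin n)) (l : Fin n → ℤ) (v : List (Fin n)) :
    torusCoeff hI hχ (nf χ I w l v) = if w = [] ∧ v = [] then Finsupp.single l 1 else 0 := by
  have h : torusCoeff hI hχ (nf χ I w l v) = coeff [] (monomialOf k w) •
      (coeff [] (monomialOf k v) • Finsupp.single l (1 : k)) := by
    rw [torusCoeff, LinearMap.comp_apply, LinearMap.comp_apply, toTriangular_nf]
    rfl
  rw [h, coeff_monomialOf, coeff_monomialOf]
  by_cases h1 : w = [] <;> by_cases h2 : v = [] <;> simp [h1, h2]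

theorem torusCoeff_K (l : Fin n → ℤ) : torusCoeff hI hχ (K χ I l) = Finsupp.single l 1 := by
  rw [← nf_nil_nil, torusCoeff_nf, if_pos ⟨rfl, rfl⟩]

end Triangular

/-! ### Symbols in the associated graded algebra. -/

section SymbolCalculus

variable {k A : Type*} [CommRing k] [Ring A] [Algebra k A] (F : ℕ → Submodule k A)

/-- The symbol map on a step of the filtration, as a linear map. -/
def symbHom (m : ℕ) : ↥(F m) →ₗ[k] AssocGraded F := DirectSum.lof k ℕ (GrPiece F) m ∘ₗ grMkHom F m

theorem symbHom_apply (m : ℕ) (a : A) (ha : a ∈ F m) : symbHom F m ⟨a, ha⟩ = symb F m a ha := rfl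

theorem symb_eq_zero {m : ℕ} {a : A} (ha : a ∈ F m) (h : a ∈ below F m) : symb F m a ha = 0 := by
  have : grMk F m a ha = 0 := (Submodule.Quotient.mk_eq_zero _).2 h
  rw [symb, this, map_zero]

theorem symb_add {m : ℕ} {a b : A} (ha : a ∈ F m) (hb : b ∈ F m) :
    symb F m (a + b) (add_mem ha hb) = symb F m a ha + symb F m b hb :=
  map_add (symbHom F m) ⟨a, ha⟩ ⟨b, hb⟩

theorem symb_smul {m : ℕ} (r : k) {a : A} (ha : a ∈ F m) :
    symb F m (r • a) ((F m).smul_mem r ha) = r • symb F m a ha :=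
  map_smul (symbHom F m) r ⟨a, ha⟩

theorem eq_top_of_symb_mem {X : Submodule k (AssocGraded F)}
    (h : ∀ m a ha, symb F m a ha ∈ X) : X = ⊤ := by
  refine eq_top_iff.2 fun x _ => ?_
  induction x using DirectSum.induction_on with
  | zero => exact zero_mem _
  | of m x =>
    obtain ⟨a, ha, rfl⟩ := grMk_surj x
    exact h m a ha
  | add x y hx hy => exact add_mem (hx trivial) (hy trivial)

end SymbolCalculus

/-! ### The weight monoid `-ℕ^n + ℤ^n_θ`. -/

section Weights

variable {n : ℕ} (τ : Equiv.Perm (Fin n))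

theorem permWeight_sroot (i : Fin n) : permWeight τ (sroot i) = sroot (τ i) := by
  funext j
  simp [permWeight, sroot, Pi.single_apply, Equiv.symm_apply_eq]

theorem permWeight_add (a b : Fin n → ℤ) :
    permWeight τ (a + b) = permWeight τ a + permWeight τ b := rfl

theorem neg_toInt_mem_polyWeights (l : Fin n → ℕ) : -toInt l ∈ polyWeights τ :=
  ⟨l, 0, zero_mem _, by rw [add_zero]; rfl⟩

theorem neg_sroot_mem_polyWeights (i : Fin n) : -sroot i ∈ polyWeights τ := by
  rw [← toInt_single]
  exact neg_toInt_mem_polyWeights τ _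

theorem sroot_sub_mem_polyWeights (hτ : ∀ i, τ (τ i) = i) (i : Fin n) :
    sroot i + -sroot (τ i) ∈ polyWeights τ := by
  refine ⟨0, sroot i + -sroot (τ i), ?_, ?_⟩
  · change -permWeight τ (sroot i + -sroot (τ i)) = _
    have h : permWeight τ (-sroot (τ i)) = -permWeight τ (sroot (τ i)) := rfl
    rw [permWeight_add, h, permWeight_sroot, permWeight_sroot, hτ]
    abel
  · funext j
    simp

theorem weightDegree_eq {l : Fin n → ℤ} (hl : l ∈ polyWeights τ) :
    (weightDegree l : ℤ) = -∑ i, l i := by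
  -- Only the sign of the coordinate sum is needed. It does not depend on the algebra, so the
  -- trivial bicharacter over `ℚ` with zero ideal serves.
  obtain ⟨w, hw, -⟩ := polyWeights_le (k := ℚ) 0 ⊥ τ hl
  simp only [weightDegree]
  omega

end Weights

/-! ### A normally ordered spanning set for each filtration step. -/

section Filtration

variable {k : Type*} [Field k] {n : ℕ} {χ : Bicharacter k n} {I : Ideal (NCPoly k n)}
  {τ : Equiv.Perm (Fin n)}

/-- The multidegrees of the normally ordered monomials in step `m` of the filtration of
`U(χ)^poly`. -/
def polyDegrees (τ : Equiv.Perm (Fin n)) (m : ℕ) : Set (Tri n) :=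
  {t | t.2.1 + toInt t.1 ∈ polyWeights τ ∧ ∑ i, toInt t.2.2 i - ∑ i, t.2.1 i ≤ m}

/-- The bounds in `polyDegrees` come from rewriting `Ẽ_w K_m F_v` as a multiple of `E_w K_l F_v`
with `l = m - wt w`: its degree `|w| - ∑ m_i + |v|` becomes `|v| - ∑ l_i`. -/
theorem polyGen_mul_mem (hτ : ∀ i, τ (τ i) = i) (g : PolyGen n) {m : ℕ} {x : Double χ I}
    (hx : x ∈ nfSpan χ I (polyDegrees τ m)) :
    polyGen χ I τ g * x ∈ nfSpan χ I (polyDegrees τ (g.deg + m)) := by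
  refine mul_mem_nfSpan (fun w l v h => ?_) hx
  obtain ⟨h1, h2⟩ := h
  simp only at h1 h2
  cases g with
  | Et i =>
    rw [polyGen, mul_assoc, K_mul_nf, mul_smul_comm, E_mul_nf]
    refine Submodule.smul_mem _ _ (nf_mem ⟨?_, ?_⟩)
    · simp only [content_cons, map_add, toInt_single]
      convert h1 using 1
      abel
    · simp only [PolyGen.deg, Pi.add_apply, Pi.neg_apply, Finset.sum_add_distrib,
        Finset.sum_neg_distrib, sum_sroot]
      push_cast
      linarith
  | F j =>
    refine nfSpan_mono ?_ (F_mul_nf j w l v)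
    rintro _ (rfl | ⟨a, ha, rfl | rfl⟩)
    · refine ⟨h1, ?_⟩
      simp only [PolyGen.deg, map_add, toInt_single, Pi.add_apply, Finset.sum_add_distrib,
        sum_sroot]
      push_cast
      linarith
    -- Cancelling `E_j` against `F_j` with `K_j` left over keeps `l + wt w` and lowers the degree.
    · simp only at ha
      rw [ha, map_add, toInt_single] at h1
      refine ⟨?_, ?_⟩
      · convert h1 using 1
        simp only
        abel
      · simp only [PolyGen.deg, Pi.add_apply, Finset.sum_add_distrib, sum_sroot]
        push_cast
        linarith
    -- With `K_j⁻¹` left over, `l + wt w` changes by `-2α_j`, which is in the weight monoid, and the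
    -- degree rises by exactly one.
    · simp only at ha
      rw [ha, map_add, toInt_single] at h1
      refine ⟨?_, ?_⟩
      · convert add_mem (add_mem h1 (neg_sroot_mem_polyWeights τ j))
          (neg_sroot_mem_polyWeights τ j) using 1
        simp only
        abel
      · simp only [PolyGen.deg, Pi.add_apply, Pi.neg_apply, Finset.sum_add_distrib,
          Finset.sum_neg_distrib, sum_sroot]
        push_cast
        linarith
  | Kinv i =>
    rw [polyGen, K_mul_nf]
    refine Submodule.smul_mem _ _ (nf_mem ⟨?_, ?_⟩)
    · simp only [add_assoc]
      exact add_mem (neg_sroot_mem_polyWeights τ i) h1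
    · simp only [PolyGen.deg, Pi.add_apply, Pi.neg_apply, Finset.sum_add_distrib,
        Finset.sum_neg_distrib, sum_sroot]
      push_cast
      linarith
  | Kth i =>
    rw [polyGen, ← K_add, K_mul_nf]
    refine Submodule.smul_mem _ _ (nf_mem ⟨?_, ?_⟩)
    · simp only [add_assoc]
      rw [← add_assoc]
      exact add_mem (sroot_sub_mem_polyWeights τ hτ i) h1
    · simp only [PolyGen.deg, Pi.add_apply, Pi.neg_apply, Finset.sum_add_distrib,
        Finset.sum_neg_distrib, sum_sroot]
      push_cast
      linarith

theorem polyFiltration_le (hτ : ∀ i, τ (τ i) = i) {m : ℕ} {a : Upoly χ I τ}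
    (ha : a ∈ polyFiltration χ I τ m) : (a : Double χ I) ∈ nfSpan χ I (polyDegrees τ m) := by
  have h : polyFiltration χ I τ m ≤
      (nfSpan χ I (polyDegrees τ m)).comap (Upoly χ I τ).val.toLinearMap := by
    refine Submodule.span_le.2 ?_
    rintro _ ⟨L, hL, rfl⟩
    have key : ∀ L : List (PolyGen n), ((L.map (polyElt χ I τ)).prod : Double χ I) ∈
        nfSpan χ I (polyDegrees τ (L.map PolyGen.deg).sum) := by
      intro L
      induction L with
      | nil => exact one_mem_nfSpan ⟨by simp, by simp⟩
      | cons g L ih => exact polyGen_mul_mem hτ g ih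
    refine nfSpan_mono ?_ (key L)
    rintro t ⟨h1, h2⟩
    exact ⟨h1, h2.trans (by exact_mod_cast hL)⟩
  exact h ha

variable (χ I τ) in
/-- A word in the elements `E_i K_i⁻¹` of `U(χ)^poly`. -/
def polyE (w : List (Fin n)) : Upoly χ I τ := ((w.map PolyGen.Et).map (polyElt χ I τ)).prod

variable (χ I τ) in
/-- A word in the elements `F_i` of `U(χ)^poly`. -/
def polyF (w : List (Fin n)) : Upoly χ I τ := ((w.map PolyGen.F).map (polyElt χ I τ)).prod

theorem prod_polyElt_mem (L : List (PolyGen n)) :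
    (L.map (polyElt χ I τ)).prod ∈ polyFiltration χ I τ (L.map PolyGen.deg).sum :=
  Submodule.subset_span ⟨L, le_rfl, rfl⟩

theorem polyE_mem (w : List (Fin n)) : polyE χ I τ w ∈ polyFiltration χ I τ w.length :=
  Submodule.subset_span ⟨w.map .Et, by simp [Function.comp_def, PolyGen.deg], rfl⟩

theorem polyF_mem (w : List (Fin n)) : polyF χ I τ w ∈ polyFiltration χ I τ w.length :=
  Submodule.subset_span ⟨w.map .F, by simp [Function.comp_def, PolyGen.deg], rfl⟩

theorem coe_polyF (w : List (Fin n)) : (polyF χ I τ w : Double χ I) = wordF χ I w := by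
  induction w with
  | nil => rfl
  | cons i w ih =>
    rw [wordF_cons, ← ih]
    rfl

theorem coe_polyE_cons (i : Fin n) (w : List (Fin n)) : (polyE χ I τ (i :: w) : Double χ I) =
    E χ I i * K χ I (-sroot i) * polyE χ I τ w := rfl

theorem exists_coe_polyE (w : List (Fin n)) : ∃ s : k, s ≠ 0 ∧
    (polyE χ I τ w : Double χ I) = s • (wordE χ I w * K χ I (-wt w)) := by
  induction w with
  | nil => exact ⟨1, one_ne_zero, by simp [wt_nil, K_zero, wordE_nil, polyE]⟩
  | cons i w ih =>
    obtain ⟨s, hs, h⟩ := ih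
    refine ⟨s * chi χ (-sroot i) (wt w), mul_ne_zero hs (chi_ne_zero _ _ _), ?_⟩
    rw [coe_polyE_cons, h, wt_cons, wordE_cons, mul_smul_comm, mul_assoc (E χ I i),
      ← mul_assoc (K χ I _),
      K_mul_wordE, neg_add, K_add, smul_mul_assoc, mul_smul_comm, smul_smul]
    simp only [mul_assoc]

/-- The normally ordered monomials of `U(χ)^poly`. -/
def polyNf (χ : Bicharacter k n) (I : Ideal (NCPoly k n)) {τ : Equiv.Perm (Fin n)}
    (w : List (Fin n)) (l : polyWeights τ) (v : List (Fin n)) : Upoly χ I τ :=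
  polyE χ I τ w * polyK χ I τ l * polyF χ I τ v

theorem polyNf_mem (w : List (Fin n)) (l : polyWeights τ) (v : List (Fin n)) :
    polyNf χ I w l v ∈ polyFiltration χ I τ
      (w.length + weightDegree (l : Fin n → ℤ) + v.length) :=
  SetLike.mul_mem_graded (SetLike.mul_mem_graded (polyE_mem w) (polyK_mem χ I τ l)) (polyF_mem v)

/-- Normal ordering never raises the filtration degree, so each step is spanned by the ordered
monomials whose own degree is within the bound. Without this, symbols could not be computed on
monomials. -/
theorem polyFiltration_le_span (hτ : ∀ i, τ (τ i) = i) (m : ℕ) :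
    polyFiltration χ I τ m ≤ Submodule.span k {a | ∃ (w : List (Fin n)) (l : polyWeights τ)
      (v : List (Fin n)), w.length + weightDegree (l : Fin n → ℤ) + v.length ≤ m ∧
        polyNf χ I w l v = a} := by
  intro a ha
  have h : nfSpan χ I (polyDegrees τ m) ≤ (Submodule.span k {a | ∃ (w : List (Fin n))
      (l : polyWeights τ) (v : List (Fin n)),
      w.length + weightDegree (l : Fin n → ℤ) + v.length ≤ m ∧ polyNf χ I w l v = a}).map
        (Upoly χ I τ).val.toLinearMap := by
    refine nfSpan_le fun w l v hS => ?_
    obtain ⟨h1, h2⟩ := hS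
    obtain ⟨s, hs, hw⟩ := exists_coe_polyE (χ := χ) (I := I) (τ := τ) w
    refine ⟨s⁻¹ • polyNf χ I w ⟨_, h1⟩ v, Submodule.smul_mem _ _ (Submodule.subset_span
      ⟨w, ⟨_, h1⟩, v, ?_, rfl⟩), ?_⟩
    -- The length of `w` cancels: the degree of the monomial is `|v| - ∑ l_i`.
    · have h3 := weightDegree_eq τ h1
      simp only [Pi.add_apply, Finset.sum_add_distrib] at h1 h2 h3
      have h4 := sum_wt w
      have h5 := sum_wt v
      simp only [wt] at h4 h5
      zify
      rw [h3]
      linarith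
    · have e : (polyNf χ I w ⟨_, h1⟩ v : Double χ I) =
          (polyE χ I τ w : Double χ I) * K χ I (l + wt w) * wordF χ I v := by
        rw [← coe_polyF (τ := τ)]
        rfl
      have e2 : s⁻¹ • (polyNf χ I w ⟨_, h1⟩ v : Double χ I) = nf χ I w l v := by
        rw [e, hw, smul_mul_assoc, smul_mul_assoc, smul_smul, inv_mul_cancel₀ hs, one_smul,
          mul_assoc (wordE χ I w), ← K_add, neg_add_cancel_comm_assoc, nf]
      exact e2
  obtain ⟨b, hb, hab⟩ := h (polyFiltration_le hτ ha)
  rwa [← Subtype.ext hab]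

theorem prod_heisGen (L : List (PolyGen n)) : (L.map (heisGen χ I τ)).prod =
    symb (polyFiltration χ I τ) (L.map PolyGen.deg).sum (L.map (polyElt χ I τ)).prod
      (prod_polyElt_mem L) := by
  induction L with
  | nil => rfl
  | cons g L ih =>
    rw [List.map_cons, List.prod_cons, ih, heisGen, symb_mul]
    rfl

theorem prod_heisGen_Et (w : List (Fin n)) : (w.map fun i => heisGen χ I τ (.Et i)).prod =
    symb (polyFiltration χ I τ) w.length (polyE χ I τ w) (polyE_mem w) := by
  have h := prod_heisGen (χ := χ) (I := I) (τ := τ) (w.map .Et)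
  rw [List.map_map] at h
  exact h.trans (symb_congr _ _ _ (by simp [Function.comp_def, PolyGen.deg]) rfl)

theorem prod_heisGen_F (w : List (Fin n)) : (w.map fun i => heisGen χ I τ (.F i)).prod =
    symb (polyFiltration χ I τ) w.length (polyF χ I τ w) (polyF_mem w) := by
  have h := prod_heisGen (χ := χ) (I := I) (τ := τ) (w.map .F)
  rw [List.map_map] at h
  exact h.trans (symb_congr _ _ _ (by simp [Function.comp_def, PolyGen.deg]) rfl)

theorem torusToPoly_single (l : polyWeights τ) (r : k) :
    (torusToPoly χ I τ (AddMonoidAlgebra.single l r) : Double χ I) = r • K χ I l :=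
  congrArg Subtype.val (AddMonoidAlgebra.lift_single _ _ _)

theorem torusToHeis_single (l : polyWeights τ) (r : k) :
    torusToHeis χ I τ (AddMonoidAlgebra.single l r) =
      r • symb (polyFiltration χ I τ) (weightDegree (l : Fin n → ℤ)) (polyK χ I τ l)
        (polyK_mem χ I τ l) :=
  AddMonoidAlgebra.lift_single _ _ _

/-- The symbol of an ordered monomial is the product of the symbols of its three factors, so it lies
in the complement unless both words are empty. -/
theorem heisTorus_sup_heisComplement (hτ : ∀ i, τ (τ i) = i) :
    heisTorus χ I τ ⊔ heisComplement χ I τ = ⊤ := by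
  refine eq_top_of_symb_mem _ fun m a ha => ?_
  have h : Submodule.span k {a | ∃ (w : List (Fin n)) (l : polyWeights τ)
      (v : List (Fin n)), w.length + weightDegree (l : Fin n → ℤ) + v.length ≤ m ∧
        polyNf χ I w l v = a} ≤
      ((heisTorus χ I τ ⊔ heisComplement χ I τ).comap (symbHom (polyFiltration χ I τ) m)).map
        (polyFiltration χ I τ m).subtype := by
    refine Submodule.span_le.2 ?_
    rintro _ ⟨w, l, v, hm, rfl⟩
    -- A monomial of smaller degree has zero symbol in degree `m`; only those of exact degree `m`
    -- contribute.
    rcases hm.lt_or_eq with hlt | rfl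
    · have hb : polyNf χ I w l v ∈ below (polyFiltration χ I τ) m :=
        Submodule.mem_iSup_of_mem _ (Submodule.mem_iSup_of_mem hlt (polyNf_mem w l v))
      have hF : polyNf χ I w l v ∈ polyFiltration χ I τ m := by
        refine Submodule.span_mono ?_ (polyNf_mem w l v)
        rintro _ ⟨L, hL, rfl⟩
        exact ⟨L, hL.trans hlt.le, rfl⟩
      refine ⟨⟨_, hF⟩, ?_, rfl⟩
      rw [SetLike.mem_coe, Submodule.mem_comap, symbHom_apply, symb_eq_zero _ hF hb]
      exact zero_mem _
    · refine ⟨⟨_, polyNf_mem w l v⟩, ?_, rfl⟩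
      rw [SetLike.mem_coe, Submodule.mem_comap, symbHom_apply]
      have e : symb (polyFiltration χ I τ) _ (polyNf χ I w l v) (polyNf_mem w l v) =
          (w.map fun i => heisGen χ I τ (.Et i)).prod *
            torusToHeis χ I τ (AddMonoidAlgebra.single l 1) *
            (v.map fun i => heisGen χ I τ (.F i)).prod := by
        rw [prod_heisGen_Et, prod_heisGen_F, torusToHeis_single, one_smul, symb_mul, symb_mul]
        rfl
      rw [e]
      by_cases hw : w = []
      · by_cases hv : v = []
        · rw [hw, hv, List.map_nil, List.map_nil, List.prod_nil, one_mul, mul_one]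
          exact Submodule.mem_sup_left ⟨_, rfl⟩
        · exact Submodule.mem_sup_right (Submodule.mem_sup_right
            (Submodule.mul_mem_mul trivial (Submodule.subset_span ⟨v, hv, rfl⟩)))
      · rw [mul_assoc]
        exact Submodule.mem_sup_right (Submodule.mem_sup_left
          (Submodule.mul_mem_mul (Submodule.subset_span ⟨w, hw, rfl⟩) trivial))
  obtain ⟨b, hb, rfl⟩ := h (polyFiltration_le_span hτ m ha)
  exact hb

end Filtration

/-! ### The decomposition (3) and the injectivity of (2). -/

section HeisenbergCoefficients

variable {k : Type*} [Field k] {n : ℕ} {χ : Bicharacter k n} {I : Ideal (NCPoly k n)}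
  {τ : Equiv.Perm (Fin n)}
  (hI : IsGradedBiideal χ I) (hχ : ∀ i j, qmat χ i j = qmat χ j i) (hτ : ∀ i, τ (τ i) = i)

/-- The part of an element of `k[ℤ^n]` that is supported on the weights with coordinate sum
`-m`. -/
def degreePart (m : ℕ) : ((Fin n → ℤ) →₀ k) →ₗ[k] ((Fin n → ℤ) →₀ k) :=
  rescale fun l => if -∑ i, l i = m then 1 else 0

/-- A pure `K_l` in step `j` has `-∑ l_i ≤ j < m`. Hence the coefficients in degree `m` depend only
on the class in the `m`-th graded piece. -/
theorem degreePart_torusCoeff_eq_zero {m j : ℕ} (hj : j < m) {x : Double χ I}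
    (hx : x ∈ nfSpan χ I (polyDegrees τ j)) : degreePart m (torusCoeff hI hχ x) = 0 := by
  refine nfSpan_le (X := LinearMap.ker (degreePart m ∘ₗ torusCoeff hI hχ)) ?_ hx
  rintro w l v ⟨-, h2⟩
  rw [LinearMap.mem_ker, LinearMap.comp_apply, torusCoeff_nf]
  split_ifs with h
  · obtain ⟨rfl, rfl⟩ := h
    simp only [content_nil, map_zero, Pi.zero_apply, Finset.sum_const_zero] at h2
    rw [degreePart, rescale_single, if_neg (by omega), zero_smul]
  · exact map_zero _

/-- The coefficients of the classes of the `K_l` in an element of the negative Heisenberg double. -/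
def heisCoeff : NegHeis χ I τ →ₗ[k] ((Fin n → ℤ) →₀ k) :=
  DirectSum.toModule k ℕ _ fun m => Submodule.liftQ _
    (degreePart m ∘ₗ torusCoeff hI hχ ∘ₗ (Upoly χ I τ).val.toLinearMap ∘ₗ
      (polyFiltration χ I τ m).subtype) (by
    intro a ha
    have h : below (polyFiltration χ I τ) m ≤ LinearMap.ker
        (degreePart m ∘ₗ torusCoeff hI hχ ∘ₗ (Upoly χ I τ).val.toLinearMap) :=
      iSup₂_le fun j hj x hx =>
        degreePart_torusCoeff_eq_zero hI hχ hj (polyFiltration_le hτ hx)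
    exact h ha)

theorem heisCoeff_symb (m : ℕ) (a : Upoly χ I τ) (ha : a ∈ polyFiltration χ I τ m) :
    heisCoeff hI hχ hτ (symb (polyFiltration χ I τ) m a ha) =
      degreePart m (torusCoeff hI hχ a) :=
  DirectSum.toModule_lof k m (grMk (polyFiltration χ I τ) m a ha)

theorem torusCoeff_E_mul (i : Fin n) (x : Double χ I) : torusCoeff hI hχ (E χ I i * x) = 0 := by
  have : torusCoeff hI hχ ∘ₗ LinearMap.mulLeft k (E χ I i) = 0 := double_ext fun w l v => by
    rw [LinearMap.comp_apply, LinearMap.mulLeft_apply, E_mul_nf, torusCoeff_nf, if_neg (by simp)]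
    rfl
  exact LinearMap.congr_fun this x

theorem torusCoeff_mul_wordF {v : List (Fin n)} (hv : v ≠ []) (x : Double χ I) :
    torusCoeff hI hχ (x * wordF χ I v) = 0 := by
  have : torusCoeff hI hχ ∘ₗ LinearMap.mulRight k (wordF χ I v) = 0 := double_ext fun w l v' => by
    rw [LinearMap.comp_apply, LinearMap.mulRight_apply, nf_mul_wordF, torusCoeff_nf,
      if_neg (by simp [hv])]
    rfl
  exact LinearMap.congr_fun this x

/-- Lifted to `U(χ)`, a product in the complement begins with some `E_i` or ends with a nonempty
word in the `F_i`. Such a product has no pure torus part in the triangular decomposition. -/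
theorem heisCoeff_of_mem_heisComplement {x : NegHeis χ I τ} (hx : x ∈ heisComplement χ I τ) :
    heisCoeff hI hχ hτ x = 0 := by
  have h : heisComplement χ I τ ≤ LinearMap.ker (heisCoeff hI hχ hτ) := by
    refine sup_le (Submodule.mul_le.2 fun a ha x _ => ?_) (Submodule.mul_le.2 fun x _ a ha => ?_)
    · have h1 : (LinearMap.ker (heisCoeff hI hχ hτ)).comap (LinearMap.mulRight k x) ≥
          augGplus χ I τ := by
        refine Submodule.span_le.2 ?_
        rintro _ ⟨w, hw, rfl⟩
        have h2 : (LinearMap.ker (heisCoeff hI hχ hτ)).comap (LinearMap.mulLeft k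
            ((w.map fun i => heisGen χ I τ (.Et i)).prod)) = ⊤ := by
          refine eq_top_of_symb_mem _ fun m b hb => ?_
          obtain ⟨i, w, rfl⟩ := List.exists_cons_of_ne_nil hw
          rw [Submodule.mem_comap, LinearMap.mem_ker, LinearMap.mulLeft_apply, prod_heisGen_Et,
            symb_mul, heisCoeff_symb, MulMemClass.coe_mul, coe_polyE_cons, mul_assoc, mul_assoc,
            torusCoeff_E_mul, map_zero]
        have h3 : x ∈ (LinearMap.ker (heisCoeff hI hχ hτ)).comap (LinearMap.mulLeft k
            ((w.map fun i => heisGen χ I τ (.Et i)).prod)) := h2 ▸ trivial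
        exact h3
      exact h1 ha
    · have h1 : (LinearMap.ker (heisCoeff hI hχ hτ)).comap (LinearMap.mulLeft k x) ≥
          augUminus χ I τ := by
        refine Submodule.span_le.2 ?_
        rintro _ ⟨w, hw, rfl⟩
        have h2 : (LinearMap.ker (heisCoeff hI hχ hτ)).comap (LinearMap.mulRight k
            ((w.map fun i => heisGen χ I τ (.F i)).prod)) = ⊤ := by
          refine eq_top_of_symb_mem _ fun m b hb => ?_
          rw [Submodule.mem_comap, LinearMap.mem_ker, LinearMap.mulRight_apply, prod_heisGen_F,
            symb_mul, heisCoeff_symb, MulMemClass.coe_mul, coe_polyF,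
            torusCoeff_mul_wordF hI hχ hw, map_zero]
        have h3 : x ∈ (LinearMap.ker (heisCoeff hI hχ hτ)).comap (LinearMap.mulRight k
            ((w.map fun i => heisGen χ I τ (.F i)).prod)) := h2 ▸ trivial
        exact h3
      exact h1 ha
  exact h hx

theorem torusCoeff_torusToPoly (a : AddMonoidAlgebra k (polyWeights τ)) :
    torusCoeff hI hχ (torusToPoly χ I τ a) = Finsupp.mapDomain Subtype.val a.coeff := by
  induction a using AddMonoidAlgebra.induction_linear with
  | zero => simp
  | add a b ha hb =>
    rw [map_add, AddMemClass.coe_add, map_add, ha, hb, AddMonoidAlgebra.coeff_add,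
      Finsupp.mapDomain_add]
  | single l r =>
    rw [torusToPoly_single, map_smul, torusCoeff_K, AddMonoidAlgebra.coeff_single,
      Finsupp.mapDomain_single, Finsupp.smul_single, smul_eq_mul, mul_one]

theorem heisCoeff_torusToHeis (a : AddMonoidAlgebra k (polyWeights τ)) :
    heisCoeff hI hχ hτ (torusToHeis χ I τ a) = Finsupp.mapDomain Subtype.val a.coeff := by
  induction a using AddMonoidAlgebra.induction_linear with
  | zero => simp
  | add a b ha hb =>
    rw [map_add, map_add, ha, hb, AddMonoidAlgebra.coeff_add, Finsupp.mapDomain_add]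
  | single l r =>
    have h : (polyK χ I τ l : Double χ I) = K χ I l := rfl
    rw [torusToHeis_single, map_smul, heisCoeff_symb, h, torusCoeff_K, degreePart, rescale_single,
      if_pos (weightDegree_eq τ l.2).symm, AddMonoidAlgebra.coeff_single,
      Finsupp.mapDomain_single, one_smul, Finsupp.smul_single, smul_eq_mul, mul_one]

theorem torusToPoly_injective (hI : IsGradedBiideal χ I) (hχ : ∀ i j, qmat χ i j = qmat χ j i) :
    Function.Injective (torusToPoly χ I τ) := fun a b h => by
  have h2 := congrArg (fun x : Upoly χ I τ => torusCoeff hI hχ x) h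
  simp only [torusCoeff_torusToPoly] at h2
  exact AddMonoidAlgebra.coeff_injective (Finsupp.mapDomain_injective Subtype.val_injective h2)

theorem torusToHeis_injective (hI : IsGradedBiideal χ I) (hχ : ∀ i j, qmat χ i j = qmat χ j i)
    (hτ : ∀ i, τ (τ i) = i) : Function.Injective (torusToHeis χ I τ) := fun a b h => by
  have h2 := congrArg (heisCoeff hI hχ hτ) h
  simp only [heisCoeff_torusToHeis] at h2
  exact AddMonoidAlgebra.coeff_injective (Finsupp.mapDomain_injective Subtype.val_injective h2)

/-- On the torus algebra `heisCoeff` is injective, while it vanishes on the complement, so the two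
meet in zero. -/
theorem isCompl_heisTorus (hI : IsGradedBiideal χ I) (hχ : ∀ i j, qmat χ i j = qmat χ j i)
    (hτ : ∀ i, τ (τ i) = i) : IsCompl (heisTorus χ I τ) (heisComplement χ I τ) := by
  refine ⟨?_, codisjoint_iff.2 (heisTorus_sup_heisComplement hτ)⟩
  rw [Submodule.disjoint_def]
  rintro _ ⟨a, rfl⟩ h
  have h2 := heisCoeff_of_mem_heisComplement hI hχ hτ h
  have h3 := (heisCoeff_torusToHeis hI hχ hτ a).symm.trans h2
  have h4 : a = 0 := AddMonoidAlgebra.coeff_injective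
    (Finsupp.mapDomain_injective Subtype.val_injective (h3.trans Finsupp.mapDomain_zero.symm))
  rw [h4, map_zero]

/-- Thus `π^∨_{0,0}` is computed in `U(χ)`, from the torus coefficients of a lift. -/
theorem projPiVee_eq {x : NegHeis χ I τ} {a : AddMonoidAlgebra k (polyWeights τ)}
    (h : heisCoeff hI hχ hτ x = Finsupp.mapDomain Subtype.val a.coeff) :
    projPiVee χ I τ x = torusToHeis χ I τ a := by
  have hc := isCompl_heisTorus hI hχ hτ
  have hx : x ∈ heisTorus χ I τ ⊔ heisComplement χ I τ := hc.sup_eq_top ▸ Submodule.mem_top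
  obtain ⟨_, ⟨b, rfl⟩, y, hy, rfl⟩ := Submodule.mem_sup.1 hx
  rw [map_add, heisCoeff_of_mem_heisComplement hI hχ hτ hy, add_zero, AlgHom.toLinearMap_apply,
    heisCoeff_torusToHeis] at h
  have hab : b = a :=
    AddMonoidAlgebra.coeff_injective (Finsupp.mapDomain_injective Subtype.val_injective h)
  rw [projPiVee, projAlong, dif_pos hc, map_add,
    Submodule.projection_apply_of_mem_left hc ⟨b, rfl⟩,
    Submodule.projection_apply_of_mem_right hc hy, add_zero, hab]
  rfl

end HeisenbergCoefficients

/-! ### Polynomials in the `B_i` and their symbols. -/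

section CoidealGenerators

variable {k : Type*} [Field k] {n : ℕ} {χ : Bicharacter k n} {I : Ideal (NCPoly k n)}
  {τ : Equiv.Perm (Fin n)}

/-- The multidegrees of the normally ordered monomials that occur in a product of elements `B_i` of
multidegree `l`. -/
def coidealDegrees (τ : Equiv.Perm (Fin n)) (l : Fin n → ℕ) : Set (Tri n) :=
  {t | (∀ i, 0 ≤ t.2.1 i - toInt t.2.2 i + toInt l i) ∧ ∃ a b : Fin n → ℕ, a + b = l ∧
    toInt t.1 + toInt b = permWeight τ (toInt a) + toInt t.2.2}

theorem sroot_nonneg (i j : Fin n) : 0 ≤ sroot i j := by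
  by_cases h : j = i
  · subst h; simp [sroot]
  · simp [sroot, h]

/-- In `coidealDegrees`, `a` counts the factors `B_i` that contributed their `E` summand and `b`
those that contributed `F_i`. Raising `l` by `α_i` offsets the largest possible drop of the
`P`-weight, and a contraction removes equal weights from both sides of the second condition. -/
theorem B_mul_mem (c : Fin n → k) (i : Fin n) {l : Fin n → ℕ} {x : Double χ I}
    (hx : x ∈ nfSpan χ I (coidealDegrees τ l)) :
    B χ I τ c i * x ∈ nfSpan χ I (coidealDegrees τ (l + Pi.single i 1)) := by
  refine mul_mem_nfSpan (fun w m v h => ?_) hx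
  obtain ⟨h1, a, b, hab, h2⟩ := h
  simp only at h1 h2
  rw [B, add_mul]
  refine add_mem ?_ ?_
  · refine nfSpan_mono ?_ (F_mul_nf i w m v)
    rintro _ (rfl | ⟨a', ha', rfl | rfl⟩)
    · refine ⟨fun j => ?_, a, b + Pi.single i 1, by rw [← add_assoc, hab], ?_⟩
      · have := h1 j
        simp only [map_add, toInt_single, Pi.add_apply]
        linarith
      · simp only [map_add, toInt_single, ← add_assoc, h2]
    · simp only at ha'
      rw [ha', map_add, toInt_single] at h2
      refine ⟨fun j => ?_, a, b + Pi.single i 1, by rw [← add_assoc, hab], ?_⟩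
      · have := h1 j
        have := sroot_nonneg i j
        simp only [map_add, toInt_single, Pi.add_apply]
        linarith
      · simp only [map_add, toInt_single, ← h2]
        abel
    · simp only at ha'
      rw [ha', map_add, toInt_single] at h2
      refine ⟨fun j => ?_, a, b + Pi.single i 1, by rw [← add_assoc, hab], ?_⟩
      · have := h1 j
        simp only [map_add, toInt_single, Pi.add_apply, Pi.neg_apply]
        linarith
      · simp only [map_add, toInt_single, ← h2]
        abel
  · rw [smul_mul_assoc, mul_assoc, K_mul_nf, mul_smul_comm, E_mul_nf]
    refine Submodule.smul_mem _ _ (Submodule.smul_mem _ _ (nf_mem ⟨fun j => ?_,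
      a + Pi.single i 1, b, by rw [add_right_comm, hab], ?_⟩))
    · have := h1 j
      simp only [map_add, toInt_single, Pi.add_apply, Pi.neg_apply]
      linarith
    · simp only [map_add, toInt_single, content_cons, permWeight_add, permWeight_sroot]
      rw [add_right_comm, h2]
      abel

theorem lift_B_mem (c : Fin n → k) {l : Fin n → ℕ} {p : NCPoly k n} (hp : p ∈ homogeneous k l) :
    FreeAlgebra.lift k (B χ I τ c) p ∈ nfSpan χ I (coidealDegrees τ l) := by
  refine mem_homogeneous_induction (P := fun p => FreeAlgebra.lift k (B χ I τ c) p ∈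
    nfSpan χ I (coidealDegrees τ l)) (fun w hw => ?_) (fun p q hp hq => ?_) ?_
    (fun r p hp => ?_) hp
  · subst hw
    clear hp
    rw [lift_monomialOf]
    induction w with
    | nil => exact one_mem_nfSpan ⟨by simp [content_nil], 0, 0, by simp [content_nil], by simp; rfl⟩
    | cons i w ih =>
      rw [List.map_cons, List.prod_cons, content_cons]
      exact B_mul_mem c i ih
  · rw [map_add]; exact add_mem hp hq
  · rw [map_zero]; exact zero_mem _
  · rw [map_smul]; exact Submodule.smul_mem _ _ hp

variable (hI : IsGradedBiideal χ I) (hχ : ∀ i j, qmat χ i j = qmat χ j i)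
  (hτ : ∀ i, τ (τ i) = i)

/-- Heart of the comparison: the pure `K_m` present satisfy `m ≥ -l` in every coordinate, so
equality of coordinate sums forces `m = -l`. -/
theorem degreePart_torusCoeff {l : Fin n → ℕ} {x : Double χ I}
    (hx : x ∈ nfSpan χ I (coidealDegrees τ l)) :
    degreePart (∑ i, l i) (torusCoeff hI hχ x) =
      Finsupp.single (-toInt l) (torusCoeff hI hχ x (-toInt l)) := by
  refine nfSpan_le (X := LinearMap.eqLocus (degreePart (∑ i, l i) ∘ₗ torusCoeff hI hχ)
    (Finsupp.lsingle (-toInt l) ∘ₗ Finsupp.lapply (-toInt l) ∘ₗ torusCoeff hI hχ)) ?_ hx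
  rintro w m v ⟨h1, -⟩
  simp only at h1
  rw [LinearMap.mem_eqLocus, LinearMap.comp_apply, LinearMap.comp_apply, LinearMap.comp_apply,
    torusCoeff_nf]
  split_ifs with h
  · obtain ⟨rfl, rfl⟩ := h
    simp only [content_nil, map_zero, Pi.zero_apply, sub_zero] at h1
    rw [degreePart, rescale_single, Finsupp.lapply_apply, Finsupp.lsingle_apply]
    by_cases hm : m = -toInt l
    · rw [if_pos (by simp [hm, toInt_apply]), one_smul, hm, Finsupp.single_eq_same]
    · rw [if_neg, zero_smul, Finsupp.single_eq_of_ne (Ne.symm hm), Finsupp.single_zero]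
      intro hs
      apply hm
      -- The nonnegative integers `m_i + l_i` sum to zero, so each of them is zero.
      have h2 : ∑ i, (m i + toInt l i) = 0 := by
        rw [Finset.sum_add_distrib]
        simp only [toInt_apply]
        push_cast at hs
        linarith
      have h3 := (Finset.sum_eq_zero_iff_of_nonneg fun i _ => h1 i).1 h2
      funext i
      have := h3 i (Finset.mem_univ i)
      simp only [Pi.neg_apply]
      linarith
  · simp

/-- For empty words the weight balance reads `b = τ(a)`, and then `a + τ(a)` is the sum of the `α_i
+ α_{τ(i)}` with multiplicities `a_i`. -/
theorem torusCoeff_eq_zero_of_notMem {l : Fin n → ℕ} (hl : l ∉ AddSubmonoid.closure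
      (Set.range fun i : Fin n => (Pi.single i 1 + Pi.single (τ i) 1 : Fin n → ℕ)))
    {x : Double χ I} (hx : x ∈ nfSpan χ I (coidealDegrees τ l)) : torusCoeff hI hχ x = 0 := by
  refine nfSpan_le (X := LinearMap.ker (torusCoeff hI hχ)) ?_ hx
  rintro w m v ⟨-, a, b, rfl, h⟩
  rw [LinearMap.mem_ker, torusCoeff_nf, if_neg]
  rintro ⟨rfl, rfl⟩
  apply hl
  simp only [content_nil, map_zero, zero_add, add_zero] at h
  have hab : a + b = ∑ i, a i • (Pi.single i 1 + Pi.single (τ i) 1 : Fin n → ℕ) := by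
    funext j
    have hj : b j = a (τ.symm j) := by
      have := congrFun h j
      simp only [permWeight, toInt_apply] at this
      exact_mod_cast this
    simp [Finset.sum_apply, Finset.sum_add_distrib, Pi.single_apply, hj, ← Equiv.symm_apply_eq]
  rw [hab]
  exact sum_mem fun i _ => nsmul_mem (AddSubmonoid.subset_closure (Set.mem_range_self i)) _

/-- Both projections are diagonal on normally ordered monomials. With both words empty, the
`P`-weight is just the weight of `K_l`. -/
theorem projPi_projP (m : Fin n → ℤ) (x : Double χ I) :
    projPi χ I 0 0 (projP χ I m x) = torusCoeff hI hχ x m • K χ I m := by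
  have h : projPi χ I 0 0 ∘ₗ projP χ I m =
      LinearMap.toSpanSingleton k _ (K χ I m) ∘ₗ Finsupp.lapply m ∘ₗ torusCoeff hI hχ :=
    double_ext fun w l v => by
      simp only [LinearMap.comp_apply, projP_nf hI hχ, torusCoeff_nf, Finsupp.lapply_apply,
        LinearMap.toSpanSingleton_apply]
      by_cases h : w = [] ∧ v = []
      · obtain ⟨rfl, rfl⟩ := h
        by_cases h2 : l = m
        · rw [if_pos (by rw [wt_nil, sub_zero, h2]), projPi_nf hI hχ]
          simp [h2, nf_nil_nil]
        · simp [wt_nil, h2]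
      · by_cases h2 : l - wt v = m <;> simp [h, h2, projPi_nf hI hχ]
  exact LinearMap.congr_fun h x

theorem projP_projPi (m : Fin n → ℤ) (x : Double χ I) :
    projP χ I m (projPi χ I 0 0 x) = torusCoeff hI hχ x m • K χ I m := by
  have h : projP χ I m ∘ₗ projPi χ I 0 0 =
      LinearMap.toSpanSingleton k _ (K χ I m) ∘ₗ Finsupp.lapply m ∘ₗ torusCoeff hI hχ :=
    double_ext fun w l v => by
      simp only [LinearMap.comp_apply, projPi_nf hI hχ, torusCoeff_nf, Finsupp.lapply_apply,
        LinearMap.toSpanSingleton_apply]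
      by_cases h : w = [] ∧ v = []
      · obtain ⟨rfl, rfl⟩ := h
        by_cases h2 : l = m
        · rw [if_pos ⟨rfl, rfl⟩, projP_nf hI hχ]
          simp [h2, wt_nil, nf_nil_nil]
        · simp [wt_nil, h2, projP_nf hI hχ]
      · simp [h]
  exact LinearMap.congr_fun h x

/-- Because `τ` is an involution, `E_{τ(i)} K_i⁻¹` equals `Ẽ_{τ(i)}` times the degree zero generator
`K_{τ(i)} K_i⁻¹`. So `B_i` lies in step one, and `B_i^∨` is its symbol. -/
theorem exists_Bvee_eq_symb (hτ : ∀ i, τ (τ i) = i) (c : Fin n → k) (i : Fin n) :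
    ∃ (b : Upoly χ I τ) (hb : b ∈ polyFiltration χ I τ 1), (b : Double χ I) = B χ I τ c i ∧
      Bvee χ I τ c i = symb (polyFiltration χ I τ) 1 b hb := by
  have h1 : polyElt χ I τ (.F i) ∈ polyFiltration χ I τ 1 := polyElt_mem χ I τ (.F i)
  have h2 : polyElt χ I τ (.Et (τ i)) * polyElt χ I τ (.Kth (τ i)) ∈ polyFiltration χ I τ 1 :=
    Submodule.subset_span ⟨[.Et (τ i), .Kth (τ i)], by simp [PolyGen.deg], by simp⟩
  refine ⟨polyElt χ I τ (.F i) + c i • (polyElt χ I τ (.Et (τ i)) * polyElt χ I τ (.Kth (τ i))),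
    add_mem h1 (Submodule.smul_mem _ _ h2), ?_, ?_⟩
  · change F χ I i + c i • (E χ I (τ i) * K χ I (-sroot (τ i)) *
      (K χ I (sroot (τ i)) * K χ I (-sroot (τ (τ i))))) = _
    rw [hτ, mul_assoc, ← mul_assoc (K χ I (-sroot (τ i))), ← K_add, neg_add_cancel, K_zero, one_mul,
      B]
  · have e : symb (polyFiltration χ I τ) 1 _ h2 =
        heisGen χ I τ (.Et (τ i)) * heisGen χ I τ (.Kth (τ i)) := by
      rw [heisGen, heisGen, symb_mul]
      exact symb_congr _ _ _ rfl rfl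
    rw [symb_add _ h1 (Submodule.smul_mem _ _ h2), symb_smul _ _ h2, Bvee, e]
    rfl

theorem exists_prod_Bvee_eq_symb (hτ : ∀ i, τ (τ i) = i) (c : Fin n → k) (w : List (Fin n)) :
    ∃ (b : Upoly χ I τ) (hb : b ∈ polyFiltration χ I τ w.length),
      (b : Double χ I) = (w.map (B χ I τ c)).prod ∧
        (w.map (Bvee χ I τ c)).prod = symb (polyFiltration χ I τ) w.length b hb := by
  induction w with
  | nil => exact ⟨1, SetLike.GradedOne.one_mem, rfl, rfl⟩
  | cons i w ih =>
    obtain ⟨b, hb, h1, h2⟩ := ih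
    obtain ⟨b', hb', h1', h2'⟩ := exists_Bvee_eq_symb (χ := χ) (I := I) hτ c i
    have hmem : b' * b ∈ polyFiltration χ I τ (1 + w.length) := SetLike.mul_mem_graded hb' hb
    refine ⟨b' * b, by rw [List.length_cons, add_comm]; exact hmem, ?_, ?_⟩
    · rw [MulMemClass.coe_mul, h1, h1', List.map_cons, List.prod_cons]
    · rw [List.map_cons, List.prod_cons, h2, h2', symb_mul]
      exact symb_congr _ _ _ (add_comm _ _) rfl

/-- All words of multidegree `l` have the same length `∑ l_i`, so `p(B^∨)` is the symbol of `p(B)`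
in that single degree. -/
theorem heisCoeff_lift_Bvee (c : Fin n → k) {l : Fin n → ℕ} {p : NCPoly k n}
    (hp : p ∈ homogeneous k l) :
    heisCoeff hI hχ hτ (FreeAlgebra.lift k (Bvee χ I τ c) p) =
      degreePart (∑ i, l i) (torusCoeff hI hχ (FreeAlgebra.lift k (B χ I τ c) p)) := by
  refine mem_homogeneous_induction (P := fun p =>
    heisCoeff hI hχ hτ (FreeAlgebra.lift k (Bvee χ I τ c) p) =
      degreePart (∑ i, l i) (torusCoeff hI hχ (FreeAlgebra.lift k (B χ I τ c) p)))
    (fun w hw => ?_) (fun p q hp hq => ?_) ?_ (fun r p hp => ?_) hp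
  · have hl : w.length = ∑ i, l i := by
      have := sum_wt w
      subst hw
      simp only [wt, toInt_apply] at this
      exact_mod_cast this.symm
    obtain ⟨b, hb, h1, h2⟩ := exists_prod_Bvee_eq_symb (χ := χ) (I := I) hτ c w
    rw [lift_monomialOf, lift_monomialOf, h2, heisCoeff_symb, h1, hl]
  · simp only [map_add, hp, hq]
  · simp only [map_zero]
  · simp only [map_smul, hp]

end CoidealGenerators

end QuantumDouble

end

/-! ### The theorem. -/

theorem theorem2p14 {k : Type*} [Field k] {n : ℕ}
    (χ : Bicharacter k n) (hχ : ∀ i j, qmat χ i j = qmat χ j i)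
    (I : Ideal (NCPoly k n)) (hI : IsGradedBiideal χ I)
    (τ : Equiv.Perm (Fin n)) (hτ : ∀ i, τ (τ i) = i)
    (hτχ : ∀ i j, qmat χ (τ i) (τ j) = qmat χ i j)
    (hτI : permHom k τ '' (I : Set (NCPoly k n)) = I)
    (c : Fin n → k) :
    -- the direct sum decompositions that define the projections
    DirectSum.IsInternal (sumP χ I) ∧
    DirectSum.IsInternal (sumPi χ I) ∧
    IsCompl (heisTorus χ I τ) (heisComplement χ I τ) ∧
    -- the algebra `k[K_l | l ∈ -ℕ^n + ℤ^n_θ]` embeds into `U(χ)^poly` and into `Heis(χ)^∨`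
    Function.Injective (torusToPoly χ I τ) ∧
    Function.Injective (torusToHeis χ I τ) ∧
    ∀ (l : Fin n → ℕ) (p : NCPoly k n), p ∈ homogeneous k l →
      -- `π_{0,0} (P_{-l} (p(B)))` and `π^∨_{0,0} (p(B^∨))` are the same element of that algebra
      (∃ a : AddMonoidAlgebra k (polyWeights τ),
        projPi χ I 0 0 (projP χ I (fun i => -(l i : ℤ)) (FreeAlgebra.lift k (B χ I τ c) p)) =
            (torusToPoly χ I τ a : Double χ I) ∧
          projPiVee χ I τ (FreeAlgebra.lift k (Bvee χ I τ c) p) = torusToHeis χ I τ a) ∧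
      -- vanishing
      (l ∉ AddSubmonoid.closure
          (Set.range fun i : Fin n => (Pi.single i 1 + Pi.single (τ i) 1 : Fin n → ℕ)) →
        projPi χ I 0 0 (projP χ I (fun i => -(l i : ℤ)) (FreeAlgebra.lift k (B χ I τ c) p)) = 0 ∧
        projP χ I (fun i => -(l i : ℤ)) (projPi χ I 0 0 (FreeAlgebra.lift k (B χ I τ c) p)) = 0 ∧
        projPiVee χ I τ (FreeAlgebra.lift k (Bvee χ I τ c) p) = 0) := by
  refine ⟨?_, ?_, isCompl_heisTorus hI hχ hτ, torusToPoly_injective hI hχ,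
    torusToHeis_injective hI hχ hτ, fun l p hp => ?_⟩
  · rw [funext (sumP_eq χ I)]
    exact (isInternal_nfSpan hI hχ _).1
  · rw [funext (sumPi_eq χ I)]
    exact (isInternal_nfSpan hI hχ _).1
  have hl : (fun i => -(l i : ℤ)) = -toInt l := rfl
  have hB := lift_B_mem (χ := χ) (I := I) (τ := τ) c hp
  set x := FreeAlgebra.lift k (B χ I τ c) p
  -- The common element is the multiple of `K_{-l}` whose scalar is the coefficient of `K_{-l}` in
  -- `p(B)`.
  have hvee : projPiVee χ I τ (FreeAlgebra.lift k (Bvee χ I τ c) p) =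
      torusToHeis χ I τ (AddMonoidAlgebra.single ⟨-toInt l, neg_toInt_mem_polyWeights τ l⟩
        (torusCoeff hI hχ x (-toInt l))) := by
    refine projPiVee_eq hI hχ hτ ?_
    rw [heisCoeff_lift_Bvee hI hχ hτ c hp, degreePart_torusCoeff hI hχ hB,
      AddMonoidAlgebra.coeff_single, Finsupp.mapDomain_single]
  rw [hl, projPi_projP hI hχ, projP_projPi hI hχ, hvee]
  refine ⟨⟨AddMonoidAlgebra.single ⟨-toInt l, neg_toInt_mem_polyWeights τ l⟩
    (torusCoeff hI hχ x (-toInt l)), 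
    (torusToPoly_single ⟨-toInt l, neg_toInt_mem_polyWeights τ l⟩ _).symm, rfl⟩, fun hnot => ?_⟩
  -- All three projections have been expressed by this one coefficient, so they vanish together.
  rw [torusCoeff_eq_zero_of_notMem hI hχ hnot hB]
  simp
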